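/- Let $n\ge 1$ and let $w:\{1,2,\dots\}\to(0,\infty)$ be a weight function, with $N_w(n)=\sum_{i=1}^n w(i)$. The biased one-sided transposition shuffle $P_{n,w}$ is the random walk on the symmetric group $S_n$ in which each step multiplies the current permutation on the left by the transposition $(i\,j)$, where $j\in\{1,\dots,n\}$ is chosen with probability $w(j)/N_w(n)$ and, given $j$, $i$ is chosen uniformly from $\{1,\dots,j\}$; here $(j\,j)$ denotes the identity. For a standard Young tableau $T$ of size $n$, write $T(i,j)$ for its entry in row $i$ and column $j$ (rows numbered from top to bottom, columns from left to right), and for $m\in\{1,\dots,n\}$ set $T(m)=j-i+1$, where $(i,j)$ is the box with $T(i,j)=m$. For a partition $\lambda$ of $n$, let $d_\lambda$ be the number of standard Young tableaux of shape $\lambda$. Put $$\mathrm{eig}(T)=\frac{1}{N_w(n)}\sum_{\text{boxes }(i,j)}\frac{j-i+1}{T(i,j)}\,w(T(i,j)).$$ Then $$\mathrm{eig}(T)=\frac{1}{N_w(n)}\sum_{m=1}^n T(m)\,\frac{w(m)}{m}$$ for every standard Young tableau $T$ of size $n$, and the eigenvalues of the transition matrix of $P_{n,w}$ are indexed by the standard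 Young tableaux of size $n$: a real number is an eigenvalue if and only if it equals $\mathrm{eig}(T)$ for some such $T$. Counted with multiplicity, each $T$ of shape $\lambda$ contributes the eigenvalue $\mathrm{eig}(T)$ exactly $d_\lambda$ times; that is, the characteristic polynomial of the transition matrix is $$\prod_{\lambda\vdash n}\ \prod_{T\in \mathrm{SYT}(\lambda)}\bigl(x-\mathrm{eig}(T)\bigr)^{d_\lambda}.$$ -/

import Mathlib

open Polynomial

noncomputable section

/-- The cumulative weight `N_w(n) = w(1) + ⋯ + w(n)`. -/
def cumulativeWeight (w : ℕ → ℝ) (n : ℕ) : ℝ := ∑ i ∈ Finset.Icc 1 n, w i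

/-- The distribution on the symmetric group generating the biased one-sided transposition shuffle:
the right hand picks the position `j` with probability `w(j) / N_w(n)`, the left hand picks `i`
uniformly from the positions `1, …, j`, and `(i j)` is applied, where `(j j)` is the identity.
The position labelled `k + 1` is represented by `k : Fin n`. -/
def biasedLaw (w : ℕ → ℝ) (n : ℕ) (τ : Equiv.Perm (Fin n)) : ℝ :=
  ∑ j : Fin n, ∑ i ∈ Finset.Iic j,
    if τ = Equiv.swap i j then
      w ((j : ℕ) + 1) / cumulativeWeight w n * (1 / (((j : ℕ) + 1 : ℕ) : ℝ))
    else 0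

/-- The transition matrix of the random walk on the symmetric group whose increments have law
`biasedLaw w n`: one moves from `σ` to `τ * σ` with probability `biasedLaw w n τ`. -/
def biasedShuffle (w : ℕ → ℝ) (n : ℕ) :
    Matrix (Equiv.Perm (Fin n)) (Equiv.Perm (Fin n)) ℝ :=
  Matrix.of fun σ ρ => biasedLaw w n (ρ * σ⁻¹)

/-- A standard Young tableau of shape `μ`: the entries are `1, …, |μ|`, once each, and they increase
along rows and down columns. The box in row `i` and column `j` is `(i, j)`, both counted from `0`;
the entry is set to `0` outside the diagram. -/
@[ext]
structure StandardYoungTableau (μ : YoungDiagram) where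
  entry : ℕ → ℕ → ℕ
  row_strict : ∀ {i j₁ j₂ : ℕ}, j₁ < j₂ → (i, j₂) ∈ μ → entry i j₁ < entry i j₂
  col_strict : ∀ {i₁ i₂ j : ℕ}, i₁ < i₂ → (i₂, j) ∈ μ → entry i₁ j < entry i₂ j
  bijOn : Set.BijOn (fun c : ℕ × ℕ => entry c.1 c.2) (μ.cells : Set (ℕ × ℕ)) (Set.Icc 1 μ.card)
  zeros : ∀ {i j : ℕ}, (i, j) ∉ μ → entry i j = 0

namespace StandardYoungTableau

instance finite (μ : YoungDiagram) : Finite (StandardYoungTableau μ) := by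
  let f : StandardYoungTableau μ → ({c : ℕ × ℕ // c ∈ μ.cells} → {m : ℕ // m ∈ Set.Icc 1 μ.card}) :=
    fun T c => ⟨T.entry c.1.1 c.1.2, T.bijOn.mapsTo c.2⟩
  refine Finite.of_injective f fun S T h => ?_
  ext i j
  by_cases hc : (i, j) ∈ μ
  · exact congrArg Subtype.val (congrFun h ⟨(i, j), by simpa using hc⟩)
  · rw [S.zeros hc, T.zeros hc]

instance fintype (μ : YoungDiagram) : Fintype (StandardYoungTableau μ) := Fintype.ofFinite _

/-- `T(m)`, which is `j - i + 1` for the box `(i, j)` of `T` that contains `m`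
(the sum below has one term when `1 ≤ m ≤ |μ|`; otherwise it is empty). -/
def diagonal {μ : YoungDiagram} (T : StandardYoungTableau μ) (m : ℕ) : ℤ :=
  ∑ c ∈ μ.cells with T.entry c.1 c.2 = m, ((c.2 : ℤ) - (c.1 : ℤ) + 1)

theorem diagonal_eq {μ : YoungDiagram} (T : StandardYoungTableau μ) {i j : ℕ} (h : (i, j) ∈ μ) :
    T.diagonal (T.entry i j) = (j : ℤ) - (i : ℤ) + 1 := by
  have hf : {c ∈ μ.cells | T.entry c.1 c.2 = T.entry i j} = {(i, j)} := by
    ext c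
    simp only [Finset.mem_filter, Finset.mem_singleton]
    constructor
    · rintro ⟨hc, he⟩
      exact T.bijOn.injOn (by simpa using hc) (by simpa using h) he
    · rintro rfl
      exact ⟨by simpa using h, rfl⟩
  rw [diagonal, hf, Finset.sum_singleton]

/-- The number attached to the tableau `T`:
`eig(T) = (1 / N_w(n)) ∑ (j - i + 1) / T(i, j) * w(T(i, j))`, over the boxes `(i, j)` of `T`,
where `n` is the size of `T`. -/
def eig (w : ℕ → ℝ) {μ : YoungDiagram} (T : StandardYoungTableau μ) : ℝ :=
  1 / cumulativeWeight w μ.card *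
    ∑ c ∈ μ.cells, ((c.2 : ℝ) - (c.1 : ℝ) + 1) / (T.entry c.1 c.2 : ℝ) * w (T.entry c.1 c.2)

end StandardYoungTableau

/-- The dimension `d_μ` of a Young diagram: its number of standard Young tableaux. -/
def YoungDiagram.dimension (μ : YoungDiagram) : ℕ := Fintype.card (StandardYoungTableau μ)

/-- The Young diagrams with `n` boxes (the partitions of `n`). -/
abbrev YoungDiagramOfSize (n : ℕ) : Type := {μ : YoungDiagram // μ.card = n}

instance YoungDiagramOfSize.finite (n : ℕ) : Finite (YoungDiagramOfSize n) := by
  have key : ∀ μ : YoungDiagramOfSize n, μ.1.cells ⊆ Finset.range n ×ˢ Finset.range n := by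
    rintro ⟨μ, rfl⟩ ⟨i, j⟩ hc
    have hc' : (i, j) ∈ μ := by simpa using hc
    have hcol : (μ.col j).card ≤ μ.card := Finset.card_le_card (Finset.filter_subset _ _)
    have hrow : (μ.row i).card ≤ μ.card := Finset.card_le_card (Finset.filter_subset _ _)
    rw [← YoungDiagram.colLen_eq_card] at hcol
    rw [← YoungDiagram.rowLen_eq_card] at hrow
    have h1 := YoungDiagram.mem_iff_lt_colLen.1 hc'
    have h2 := YoungDiagram.mem_iff_lt_rowLen.1 hc'
    simp only [Finset.mem_product, Finset.mem_range]
    omega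
  let f : YoungDiagramOfSize n → (Finset.range n ×ˢ Finset.range n).powerset :=
    fun μ => ⟨μ.1.cells, Finset.mem_powerset.2 (key μ)⟩
  refine Finite.of_injective f fun μ ν h => ?_
  exact Subtype.ext (YoungDiagram.ext (congrArg Subtype.val h))

instance YoungDiagramOfSize.fintype (n : ℕ) : Fintype (YoungDiagramOfSize n) := Fintype.ofFinite _

end

/-! On functions on the symmetric group the shuffle acts as a combination of the operators `1 +
J_j`, where `J_j f(σ) = ∑_{i<j} f((i j)σ)` is a left Jucys–Murphy operator (`biasedShuffle_mulVec`).
It therefore suffices to diagonalise all `J_j` at once, with the contents of tableaux as eigenvalues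
and each tableau repeated `d_λ` times.

This is done without representation theory. For every pair `(S, T)` of tableaux of equal shape there
is a nonzero function on which the left operators act by the contents of `S` and the right ones by
those of `T`. The Specht polynomial of the columnwise tableau gives a right eigenfunction; its
autocorrelation is a two-sided one with equal weights. Intertwiners (`IsJointWeight.comp_swap`) then
exchange consecutive contents that differ by at least two, and such exchanges connect all tableaux
of a shape (`diagonal_induction`).

Contents determine the tableau, so these functions have distinct systems of eigenvalues and are
linearly independent. There are `∑ d_λ² = n!` of them (`sum_dimension_sq`, from the commutation
relation of Young's lattice), so they form a basis. -/

noncomputable section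

/-! ### Contents of addable and removable boxes. -/

namespace YoungDiagram

/-- The sum of `j - i + 1` over the boxes `(i, j)` of a Young diagram. -/
def contentSum (μ : YoungDiagram) : ℤ := ∑ c ∈ μ.cells, ((c.2 : ℤ) - (c.1 : ℤ) + 1)

theorem contentSum_sup_add_inf (μ ν : YoungDiagram) :
    (μ ⊔ ν).contentSum + (μ ⊓ ν).contentSum = μ.contentSum + ν.contentSum := by
  simp only [contentSum, cells_sup, cells_inf]
  exact Finset.sum_union_inter

theorem card_sup_add_inf (μ ν : YoungDiagram) :
    (μ ⊔ ν).card + (μ ⊓ ν).card = μ.card + ν.card := by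
  simpa only [YoungDiagram.card, cells_sup, cells_inf] using
    Finset.card_union_add_card_inter μ.cells ν.cells

theorem eq_of_le_of_card_le {μ ν : YoungDiagram} (h : μ ≤ ν) (hc : ν.card ≤ μ.card) : μ = ν :=
  YoungDiagram.ext (Finset.eq_of_subset_of_card_le (cells_subset_iff.2 h) hc)

theorem exists_cells_eq_insert {ν μ : YoungDiagram} (h : ν ≤ μ) (hc : μ.card = ν.card + 1) :
    ∃ c, c ∉ ν ∧ μ.cells = insert c ν.cells := by
  obtain ⟨c, h1, h2⟩ := Finset.exists_eq_insert_iff.2 ⟨cells_subset_iff.2 h, hc.symm⟩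
  exact ⟨c, by simpa using h1, h2.symm⟩

theorem mem_of_cells_eq_insert {ν μ : YoungDiagram} {c : ℕ × ℕ} (h : μ.cells = insert c ν.cells)
    {x : ℕ × ℕ} : x ∈ μ ↔ x = c ∨ x ∈ ν := by
  rw [← mem_cells, h, Finset.mem_insert, mem_cells]

theorem contentSum_of_cells_eq_insert {ν μ : YoungDiagram} {c : ℕ × ℕ} (hc : c ∉ ν)
    (h : μ.cells = insert c ν.cells) :
    μ.contentSum = ν.contentSum + ((c.2 : ℤ) - (c.1 : ℤ) + 1) := by
  rw [contentSum, h, Finset.sum_insert (by simpa using hc), contentSum, add_comm]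

/-- A diagram covering `ν` is determined by the content of the new box. -/
theorem eq_of_contentSum_eq {ν μ μ' : YoungDiagram} (h : ν ≤ μ) (hc : μ.card = ν.card + 1)
    (h' : ν ≤ μ') (hc' : μ'.card = ν.card + 1) (hS : μ.contentSum = μ'.contentSum) : μ = μ' := by
  obtain ⟨⟨i, j⟩, hn, he⟩ := exists_cells_eq_insert h hc
  obtain ⟨⟨i', j'⟩, hn', he'⟩ := exists_cells_eq_insert h' hc'
  rw [contentSum_of_cells_eq_insert hn he, contentSum_of_cells_eq_insert hn' he'] at hS
  simp only at hS
  have hA : (i, j) ∈ μ := (mem_of_cells_eq_insert he).2 (Or.inl rfl)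
  have hA' : (i', j') ∈ μ' := (mem_of_cells_eq_insert he').2 (Or.inl rfl)
  rcases lt_trichotomy i i' with hi | hi | hi
  -- Equal contents put both new boxes on one diagonal; the upper-left one then lies in the other
  -- diagram without being its new box, hence already in `ν`.
  · rcases (mem_of_cells_eq_insert he').1 (μ'.up_left_mem hi.le (by omega : j ≤ j') hA') with h | h
    · simp only [Prod.mk.injEq] at h; omega
    · exact absurd h hn
  · obtain rfl : j = j' := by omega
    subst hi
    exact YoungDiagram.ext (he.trans he'.symm)
  · rcases (mem_of_cells_eq_insert he).1 (μ.up_left_mem hi.le (by omega : j' ≤ j) hA) with h | h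
    · simp only [Prod.mk.injEq] at h; omega
    · exact absurd h hn'

/-- The contents of two different removable boxes of a diagram differ by at least two. -/
theorem two_le_abs_contentSum_sub {ν ν' μ : YoungDiagram} (h : ν ≤ μ) (hc : μ.card = ν.card + 1)
    (h' : ν' ≤ μ) (hc' : μ.card = ν'.card + 1) (hne : ν ≠ ν') :
    2 ≤ |ν.contentSum - ν'.contentSum| := by
  obtain ⟨⟨i, j⟩, hn, he⟩ := exists_cells_eq_insert h hc
  obtain ⟨⟨i', j'⟩, hn', he'⟩ := exists_cells_eq_insert h' hc'
  have hS := contentSum_of_cells_eq_insert hn he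
  have hS' := contentSum_of_cells_eq_insert hn' he'
  simp only at hS hS'
  have hA : (i, j) ∈ μ := (mem_of_cells_eq_insert he).2 (Or.inl rfl)
  have hA' : (i', j') ∈ μ := (mem_of_cells_eq_insert he').2 (Or.inl rfl)
  have hAne : (i, j) ≠ (i', j') := by
    intro heq
    refine hne (YoungDiagram.ext ?_)
    have h1 : ν.cells = μ.cells.erase (i, j) := by
      rw [he, Finset.erase_insert (by simpa using hn)]
    have h2 : ν'.cells = μ.cells.erase (i', j') := by
      rw [he', Finset.erase_insert (by simpa using hn')]
    rw [h1, h2, heq]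
  have hB : (i', j') ∈ ν := ((mem_of_cells_eq_insert he).1 hA').resolve_left (Ne.symm hAne)
  have hB' : (i, j) ∈ ν' := ((mem_of_cells_eq_insert he').1 hA).resolve_left hAne
  -- Neither removable box is weakly up-left of the other, so rows and columns differ strictly and
  -- in opposite directions; each contributes at least one to the difference of contents.
  have h1 : ¬ (i ≤ i' ∧ j ≤ j') := fun hh => hn (ν.up_left_mem hh.1 hh.2 hB)
  have h2 : ¬ (i' ≤ i ∧ j' ≤ j) := fun hh => hn' (ν'.up_left_mem hh.1 hh.2 hB')
  rw [le_abs]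
  omega

end YoungDiagram

/-! ### Adding and removing the largest entry of a tableau. -/

namespace StandardYoungTableau

variable {μ ν : YoungDiagram}

theorem entry_mem_Icc (T : StandardYoungTableau μ) {i j : ℕ} (h : (i, j) ∈ μ) :
    1 ≤ T.entry i j ∧ T.entry i j ≤ μ.card :=
  T.bijOn.mapsTo (show ((i, j) : ℕ × ℕ) ∈ (μ.cells : Set (ℕ × ℕ)) by simpa using h)

theorem entry_le_card (T : StandardYoungTableau μ) (i j : ℕ) : T.entry i j ≤ μ.card := by
  by_cases h : (i, j) ∈ μ
  · exact (T.entry_mem_Icc h).2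
  · simp [T.zeros h]

/-- The tableau obtained by writing the largest entry into the box added to `ν`. -/
def extend (h : ν ≤ μ) (hc : μ.card = ν.card + 1) (U : StandardYoungTableau ν) :
    StandardYoungTableau μ where
  entry i j := if (i, j) ∈ μ ∧ (i, j) ∉ ν then μ.card else U.entry i j
  row_strict {i j₁ j₂} hj hm := by
    obtain ⟨c, hn, he⟩ := YoungDiagram.exists_cells_eq_insert h hc
    have hm1 : (i, j₁) ∈ μ := μ.up_left_mem le_rfl hj.le hm
    by_cases h2 : (i, j₂) ∈ ν
    · have h1 : (i, j₁) ∈ ν := ν.up_left_mem le_rfl hj.le h2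
      simpa [h1, h2] using U.row_strict hj h2
    · have h2' := ((YoungDiagram.mem_of_cells_eq_insert he).1 hm).resolve_right h2
      have h1 : (i, j₁) ∈ ν := by
        refine ((YoungDiagram.mem_of_cells_eq_insert he).1 hm1).resolve_left fun h1' => ?_
        have := h1'.trans h2'.symm
        simp only [Prod.mk.injEq] at this
        omega
      have := U.entry_le_card i j₁
      simp only [hm, h2, h1, not_true_eq_false, and_false, if_false, not_false_eq_true, and_self,
        if_true]
      omega
  col_strict {i₁ i₂ j} hi hm := by
    obtain ⟨c, hn, he⟩ := YoungDiagram.exists_cells_eq_insert h hc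
    have hm1 : (i₁, j) ∈ μ := μ.up_left_mem hi.le le_rfl hm
    by_cases h2 : (i₂, j) ∈ ν
    · have h1 : (i₁, j) ∈ ν := ν.up_left_mem hi.le le_rfl h2
      simpa [h1, h2] using U.col_strict hi h2
    · have h2' := ((YoungDiagram.mem_of_cells_eq_insert he).1 hm).resolve_right h2
      have h1 : (i₁, j) ∈ ν := by
        refine ((YoungDiagram.mem_of_cells_eq_insert he).1 hm1).resolve_left fun h1' => ?_
        have := h1'.trans h2'.symm
        simp only [Prod.mk.injEq] at this
        omega
      have := U.entry_le_card i₁ j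
      simp only [hm, h2, h1, not_true_eq_false, and_false, if_false, not_false_eq_true, and_self,
        if_true]
      omega
  bijOn := by
    obtain ⟨c, hn, he⟩ := YoungDiagram.exists_cells_eq_insert h hc
    have hcμ : c ∈ μ := (YoungDiagram.mem_of_cells_eq_insert he).2 (Or.inl rfl)
    have hI : Set.Icc 1 μ.card = insert μ.card (Set.Icc 1 ν.card) := by
      ext m; simp only [Set.mem_Icc, Set.mem_insert_iff]; omega
    have hU : Set.BijOn (fun c : ℕ × ℕ => if (c.1, c.2) ∈ μ ∧ (c.1, c.2) ∉ ν then μ.card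
        else U.entry c.1 c.2) (ν.cells : Set (ℕ × ℕ)) (Set.Icc 1 ν.card) := by
      refine U.bijOn.congr fun x hx => ?_
      have hx' : x ∈ ν := by simpa using hx
      simp [hx']
    rw [he, Finset.coe_insert, hI]
    have := hU.insert (a := c)
    have hv : (if (c.1, c.2) ∈ μ ∧ (c.1, c.2) ∉ ν then μ.card
        else U.entry c.1 c.2) = μ.card := by
      simp [hcμ, hn]
    rw [hv] at this
    exact this (by simp only [Set.mem_Icc]; omega)
  zeros {i j} hm := by
    simp only [hm, false_and, if_false]
    exact U.zeros fun hh => hm (h hh)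

theorem extend_entry (h : ν ≤ μ) (hc : μ.card = ν.card + 1) (U : StandardYoungTableau ν)
    (i j : ℕ) : (U.extend h hc).entry i j =
      if (i, j) ∈ μ ∧ (i, j) ∉ ν then μ.card else U.entry i j := rfl

theorem diagonal_eq_zero (T : StandardYoungTableau μ) {m : ℕ} (hm : m = 0 ∨ μ.card < m) :
    T.diagonal m = 0 := by
  refine Finset.sum_eq_zero fun c hc => ?_
  rw [Finset.mem_filter] at hc
  have := T.entry_mem_Icc (i := c.1) (j := c.2) (by simpa using hc.1)
  omega

theorem diagonal_extend (h : ν ≤ μ) (hc : μ.card = ν.card + 1) (U : StandardYoungTableau ν) :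
    (U.extend h hc).diagonal =
      Function.update U.diagonal μ.card (μ.contentSum - ν.contentSum) := by
  obtain ⟨c, hn, he⟩ := YoungDiagram.exists_cells_eq_insert h hc
  have hcμ : c ∈ μ := (YoungDiagram.mem_of_cells_eq_insert he).2 (Or.inl rfl)
  ext m
  have h1 : (U.extend h hc).diagonal m =
      (if μ.card = m then ((c.2 : ℤ) - (c.1 : ℤ) + 1) else 0) + U.diagonal m := by
    rw [diagonal, Finset.sum_filter, he, Finset.sum_insert (by simpa using hn), diagonal,
      Finset.sum_filter]
    congr 1
    · simp [extend_entry, hcμ, hn]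
    · refine Finset.sum_congr rfl fun x hx => ?_
      have hx' : x ∈ ν := by simpa using hx
      simp [extend_entry, hx']
  rw [h1, YoungDiagram.contentSum_of_cells_eq_insert hn he]
  by_cases hm : m = μ.card
  · subst hm
    rw [U.diagonal_eq_zero (Or.inr (by omega))]
    simp
  · rw [Function.update_of_ne hm, if_neg (Ne.symm hm), zero_add]

theorem exists_eq_extend (T : StandardYoungTableau μ) (hμ : μ.card ≠ 0) :
    ∃ (ν : YoungDiagram) (h : ν ≤ μ) (hc : μ.card = ν.card + 1) (U : StandardYoungTableau ν),
      T = U.extend h hc := by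
  obtain ⟨c, hcm, hce⟩ := T.bijOn.surjOn (show μ.card ∈ Set.Icc 1 μ.card from
    ⟨Nat.one_le_iff_ne_zero.2 hμ, le_rfl⟩)
  have hcm : c ∈ μ := by simpa using hcm
  simp only at hce
  -- The box of the maximal entry is a corner: any other box of `μ` weakly below and to the right of
  -- it would have a larger entry.
  let ν : YoungDiagram := ⟨μ.cells.erase c, by
    rintro ⟨i, j⟩ ⟨i', j'⟩ hle hm
    have h1 : i' ≤ i := hle.1
    have h2 : j' ≤ j := hle.2
    simp only [Finset.coe_erase, Set.mem_sdiff, Finset.mem_coe, YoungDiagram.mem_cells,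
      Set.mem_singleton_iff] at hm ⊢
    refine ⟨μ.up_left_mem h1 h2 hm.1, fun heq => ?_⟩
    subst heq
    simp only at hce
    have h3 := T.entry_le_card i j
    rcases h1.lt_or_eq with hi | rfl
    · have := T.col_strict hi (μ.up_left_mem le_rfl h2 hm.1)
      rcases h2.lt_or_eq with hj | rfl
      · have := T.row_strict hj hm.1
        omega
      · omega
    · rcases h2.lt_or_eq with hj | rfl
      · have := T.row_strict hj hm.1
        omega
      · exact hm.2 rfl⟩
  have hνm : ∀ x, x ∈ ν ↔ x ≠ c ∧ x ∈ μ := fun x => by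
    rw [← YoungDiagram.mem_cells]; simp [ν]
  have hν : ν ≤ μ := fun x hx => ((hνm x).1 hx).2
  have hcard : μ.card = ν.card + 1 := by
    have : ν.card = μ.card - 1 := Finset.card_erase_of_mem (by simpa using hcm)
    omega
  have hne : ∀ x ∈ ν, T.entry x.1 x.2 ≠ μ.card := fun x hx heq => by
    refine ((hνm x).1 hx).1 (T.bijOn.injOn ?_ ?_ (heq.trans hce.symm))
    · simpa using hν hx
    · simpa using hcm
  refine ⟨ν, hν, hcard, ⟨fun i j => if (i, j) ∈ ν then T.entry i j else 0, ?_, ?_, ?_, ?_⟩, ?_⟩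
  · intro i j₁ j₂ hj hm
    simpa [hm, ν.up_left_mem le_rfl hj.le hm] using T.row_strict hj (hν hm)
  · intro i₁ i₂ j hi hm
    simpa [hm, ν.up_left_mem hi.le le_rfl hm] using T.col_strict hi (hν hm)
  · have hb : Set.BijOn (fun c : ℕ × ℕ => T.entry c.1 c.2) (ν.cells : Set (ℕ × ℕ))
        (Set.Icc 1 ν.card) := by
      refine ⟨fun x hx => ?_, T.bijOn.injOn.mono (by simpa using YoungDiagram.cells_subset_iff.2 hν),
        fun m hm => ?_⟩
      · have hx' : x ∈ ν := by simpa using hx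
        have h1 := T.entry_mem_Icc (i := x.1) (j := x.2) (hν hx')
        have h2 := hne x hx'
        simp only [Set.mem_Icc]
        omega
      · obtain ⟨x, hx, rfl⟩ := T.bijOn.surjOn (show m ∈ Set.Icc 1 μ.card from
          ⟨hm.1, by have := hm.2; omega⟩)
        refine ⟨x, ?_, rfl⟩
        have : x ∈ ν := (hνm x).2 ⟨?_, by simpa using hx⟩
        · simpa using this
        · rintro rfl
          have := hm.2
          simp only at this
          omega
    refine hb.congr fun x hx => ?_
    have hx' : x ∈ ν := by simpa using hx
    simp [hx']
  · intro i j hm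
    simp [hm]
  · ext i j
    rw [extend_entry]
    by_cases h1 : (i, j) ∈ ν
    · simp [h1]
    · by_cases h2 : (i, j) ∈ μ
      · have : (i, j) = c := by
          by_contra hh
          exact h1 ((hνm _).2 ⟨hh, h2⟩)
        subst this
        simp [h1, h2, hce]
      · simp [h1, h2, T.zeros h2]

/-- Entries of `U` are at most `ν.card < μ.card`, so the smaller shape can be read off from the
extended tableau. -/
theorem mem_iff_of_extend {h : ν ≤ μ} {hc : μ.card = ν.card + 1} (U : StandardYoungTableau ν)
    (i j : ℕ) : (i, j) ∈ ν ↔ (i, j) ∈ μ ∧ (U.extend h hc).entry i j ≠ μ.card := by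
  rw [extend_entry]
  by_cases h1 : (i, j) ∈ ν
  · have := U.entry_le_card i j
    simp only [h1, h h1, not_true_eq_false, and_false, if_false, true_and, true_iff]
    omega
  · simp only [h1, not_false_eq_true, and_true, false_iff]
    intro hh
    simp [hh.1] at hh

theorem extend_injective {ν' : YoungDiagram} {h : ν ≤ μ} {hc : μ.card = ν.card + 1}
    {h' : ν' ≤ μ} {hc' : μ.card = ν'.card + 1} {U : StandardYoungTableau ν}
    {U' : StandardYoungTableau ν'} (he : U.extend h hc = U'.extend h' hc') :
    ν = ν' ∧ HEq U U' := by
  obtain rfl : ν = ν' := by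
    ext ⟨i, j⟩
    rw [YoungDiagram.mem_cells, YoungDiagram.mem_cells, U.mem_iff_of_extend (h := h) (hc := hc),
      U'.mem_iff_of_extend (h := h') (hc := hc'), he]
  refine ⟨rfl, heq_of_eq ?_⟩
  ext i j
  by_cases h1 : (i, j) ∈ ν
  · have := congrArg (fun T => T.entry i j) he
    simpa [extend_entry, h1] using this
  · rw [U.zeros h1, U'.zeros h1]

end StandardYoungTableau

/-! ### Young's lattice and the sum of the squared dimensions. -/

namespace YoungDiagram

/-- `μ` with a box added at the end of row `i`. -/
def addBox (μ : YoungDiagram) (i : ℕ) (hi : i = 0 ∨ μ.rowLen i < μ.rowLen (i - 1)) :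
    YoungDiagram where
  cells := insert (i, μ.rowLen i) μ.cells
  isLowerSet := by
    rintro ⟨a, b⟩ ⟨a', b'⟩ hle hm
    have h1 : a' ≤ a := hle.1
    have h2 : b' ≤ b := hle.2
    simp only [Finset.coe_insert, Set.mem_insert_iff, Finset.mem_coe, mem_cells, Prod.mk.injEq,
      mem_iff_lt_rowLen] at hm ⊢
    rcases hm with ⟨rfl, rfl⟩ | hm
    · rcases h1.lt_or_eq with h | rfl
      · have := μ.rowLen_anti a' (a - 1) (by omega)
        omega
      · omega
    · have := μ.rowLen_anti a' a h1
      omega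

/-- `μ` with the last box of row `i` removed. -/
def removeBox (μ : YoungDiagram) (i : ℕ) (hi : μ.rowLen (i + 1) < μ.rowLen i) :
    YoungDiagram where
  cells := μ.cells.erase (i, μ.rowLen i - 1)
  isLowerSet := by
    rintro ⟨a, b⟩ ⟨a', b'⟩ hle hm
    have h1 : a' ≤ a := hle.1
    have h2 : b' ≤ b := hle.2
    simp only [Finset.coe_erase, Set.mem_sdiff, Set.mem_singleton_iff, Finset.mem_coe, mem_cells,
      Prod.mk.injEq, mem_iff_lt_rowLen] at hm ⊢
    have := μ.rowLen_anti a' a h1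
    refine ⟨by omega, ?_⟩
    rintro ⟨rfl, rfl⟩
    rcases h1.lt_or_eq with h | rfl
    · have := μ.rowLen_anti (a' + 1) a (by omega)
      omega
    · omega

theorem card_addBox (μ : YoungDiagram) (i : ℕ) (hi : i = 0 ∨ μ.rowLen i < μ.rowLen (i - 1)) :
    (μ.addBox i hi).card = μ.card + 1 :=
  Finset.card_insert_of_notMem (by simp [mem_iff_lt_rowLen])

theorem card_removeBox (μ : YoungDiagram) (i : ℕ) (hi : μ.rowLen (i + 1) < μ.rowLen i) :
    (μ.removeBox i hi).card + 1 = μ.card :=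
  Finset.card_erase_add_one (by simp [mem_iff_lt_rowLen]; omega)

/-- Row `0` always accepts a box, and row `i + 1` accepts one exactly when row `i` can lose one. -/
theorem card_upper_eq_card_lower_add_one (n : ℕ) (ν : YoungDiagramOfSize (n + 1)) :
    Nat.card {μ : YoungDiagramOfSize (n + 2) // ν.1 ≤ μ.1} =
      Nat.card {κ : YoungDiagramOfSize n // κ.1 ≤ ν.1} + 1 := by
  obtain ⟨ν, hν⟩ := ν
  simp only
  let f : {i : ℕ // i = 0 ∨ ν.rowLen i < ν.rowLen (i - 1)} →
      {μ : YoungDiagramOfSize (n + 2) // ν ≤ μ.1} := fun i =>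
    ⟨⟨ν.addBox i.1 i.2, by rw [card_addBox, hν]⟩,
      cells_subset_iff.1 (Finset.subset_insert _ _)⟩
  let g : {i : ℕ // ν.rowLen (i + 1) < ν.rowLen i} →
      {κ : YoungDiagramOfSize n // κ.1 ≤ ν} := fun i =>
    ⟨⟨ν.removeBox i.1 i.2, by have := card_removeBox ν i.1 i.2; omega⟩,
      cells_subset_iff.1 (Finset.erase_subset _ _)⟩
  have hf : Function.Bijective f := by
    constructor
    · rintro ⟨i, hi⟩ ⟨i', hi'⟩ h
      have h1 : insert (i, ν.rowLen i) ν.cells = insert (i', ν.rowLen i') ν.cells :=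
        congrArg (fun μ => μ.1.1.cells) h
      have h2 : (i, ν.rowLen i) ∈ insert (i', ν.rowLen i') ν.cells :=
        h1 ▸ Finset.mem_insert_self _ _
      simp only [Finset.mem_insert, Prod.mk.injEq, mem_cells, mem_iff_lt_rowLen, lt_irrefl,
        or_false] at h2
      exact Subtype.ext h2.1
    · rintro ⟨⟨μ, hμ⟩, hle⟩
      obtain ⟨⟨i, j⟩, hn, he⟩ := exists_cells_eq_insert hle (by change μ.card = _; omega)
      have hm : (i, j) ∈ μ := (mem_of_cells_eq_insert he).2 (Or.inl rfl)
      rw [mem_iff_lt_rowLen] at hn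
      have hj : j = ν.rowLen i := by
        by_contra hh
        have h1 := μ.up_left_mem le_rfl (by omega : ν.rowLen i ≤ j) hm
        simp only [mem_of_cells_eq_insert he, mem_iff_lt_rowLen, Prod.mk.injEq] at h1
        omega
      subst hj
      have hi : i = 0 ∨ ν.rowLen i < ν.rowLen (i - 1) := by
        by_contra! hh
        have h1 := μ.up_left_mem (by omega : i - 1 ≤ i) le_rfl hm
        simp only [mem_of_cells_eq_insert he, mem_iff_lt_rowLen, Prod.mk.injEq] at h1
        omega
      exact ⟨⟨i, hi⟩, Subtype.ext (Subtype.ext (YoungDiagram.ext he.symm))⟩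
  have hg : Function.Bijective g := by
    constructor
    · rintro ⟨i, hi⟩ ⟨i', hi'⟩ h
      have h1 : ν.cells.erase (i, ν.rowLen i - 1) = ν.cells.erase (i', ν.rowLen i' - 1) :=
        congrArg (fun μ => μ.1.1.cells) h
      have h2 : (i, ν.rowLen i - 1) ∉ ν.cells.erase (i', ν.rowLen i' - 1) :=
        h1 ▸ Finset.notMem_erase _ _
      simp only [Finset.mem_erase, ne_eq, Prod.mk.injEq, mem_cells, mem_iff_lt_rowLen] at h2
      refine Subtype.ext ?_
      by_contra hh
      exact h2 ⟨fun h3 => hh h3.1, by omega⟩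
    · rintro ⟨⟨κ, hκ⟩, hle⟩
      obtain ⟨⟨i, j⟩, hn, he⟩ := exists_cells_eq_insert hle (by change _ = κ.card + 1; omega)
      have hm : (i, j) ∈ ν := (mem_of_cells_eq_insert he).2 (Or.inl rfl)
      rw [mem_iff_lt_rowLen] at hm
      have hj : j = ν.rowLen i - 1 := by
        by_contra hh
        have h1 : (i, ν.rowLen i - 1) ∈ ν := by rw [mem_iff_lt_rowLen]; omega
        rw [mem_of_cells_eq_insert he, Prod.mk.injEq] at h1
        exact hn (κ.up_left_mem le_rfl (by omega) (h1.resolve_left fun h => hh h.2.symm))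
      have hi : ν.rowLen (i + 1) < ν.rowLen i := by
        by_contra! hh
        have h1 : (i + 1, j) ∈ ν := by rw [mem_iff_lt_rowLen]; omega
        rw [mem_of_cells_eq_insert he, Prod.mk.injEq] at h1
        exact hn (κ.up_left_mem (Nat.le_succ i) le_rfl (h1.resolve_left fun h => by omega))
      subst hj
      refine ⟨⟨i, hi⟩, Subtype.ext (Subtype.ext (YoungDiagram.ext ?_))⟩
      change ν.cells.erase (i, ν.rowLen i - 1) = κ.cells
      conv_lhs => rw [he]
      exact Finset.erase_insert (by simpa using hn)
  have : Finite {i : ℕ // ν.rowLen (i + 1) < ν.rowLen i} := Finite.of_injective g hg.1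
  rw [← Nat.card_eq_of_bijective f hf, ← Nat.card_eq_of_bijective g hg, ← Finite.card_option]
  refine Nat.card_congr ⟨fun i => if h : i.1 = 0 then none else
      some ⟨i.1 - 1, by
        have := i.2.resolve_left h
        rwa [Nat.sub_add_cancel (Nat.one_le_iff_ne_zero.2 h)]⟩,
    fun o => o.elim ⟨0, Or.inl rfl⟩ fun i => ⟨i.1 + 1, Or.inr i.2⟩, ?_, ?_⟩
  · rintro ⟨i, hi⟩
    by_cases h : i = 0
    · simp [h]
    · simp only [h, dite_false, Option.elim_some, Subtype.mk.injEq]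
      omega
  · rintro (_ | ⟨i, hi⟩)
    · simp
    · simp

-- The relation `DU - UD = 1` of the up and down operators, entry by entry. Off the diagonal, a
-- common upper cover can only be the join and a common lower cover only the meet; since their sizes
-- have a fixed sum, one has the required size exactly when the other does.
open Classical in
theorem card_common_upper (n : ℕ) (ν ν' : YoungDiagramOfSize (n + 1)) :
    Nat.card {μ : YoungDiagramOfSize (n + 2) // ν.1 ≤ μ.1 ∧ ν'.1 ≤ μ.1} =
      Nat.card {κ : YoungDiagramOfSize n // κ.1 ≤ ν.1 ∧ κ.1 ≤ ν'.1} +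
        if ν' = ν then 1 else 0 := by
  by_cases h : ν' = ν
  · subst h
    simpa using card_upper_eq_card_lower_add_one n ν'
  rw [if_neg h, add_zero]
  obtain ⟨ν, hν⟩ := ν
  obtain ⟨ν', hν'⟩ := ν'
  have hne : ν' ≠ ν := fun hh => h (Subtype.ext hh)
  simp only
  have hcard := card_sup_add_inf ν ν'
  have h1 : n + 1 < (ν ⊔ ν').card := by
    by_contra! hh
    have h1 := eq_of_le_of_card_le (le_sup_left (a := ν) (b := ν')) (by omega)
    have h2 := eq_of_le_of_card_le (le_sup_right (a := ν) (b := ν')) (by omega)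
    exact hne (h2.trans h1.symm)
  have hup : ∀ μ : {μ : YoungDiagramOfSize (n + 2) // ν ≤ μ.1 ∧ ν' ≤ μ.1},
      ν ⊔ ν' = μ.1.1 := fun μ =>
    eq_of_le_of_card_le (sup_le μ.2.1 μ.2.2) (by have := μ.1.2; omega)
  have hdn : ∀ κ : {κ : YoungDiagramOfSize n // κ.1 ≤ ν ∧ κ.1 ≤ ν'},
      κ.1.1 = ν ⊓ ν' := fun κ =>
    eq_of_le_of_card_le (le_inf κ.2.1 κ.2.2) (by have := κ.1.2; omega)
  refine Nat.card_congr ⟨fun μ => ⟨⟨ν ⊓ ν', ?_⟩, inf_le_left, inf_le_right⟩,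
    fun κ => ⟨⟨ν ⊔ ν', ?_⟩, le_sup_left, le_sup_right⟩, fun μ => ?_, fun κ => ?_⟩
  · have := hup μ
    have := congrArg YoungDiagram.card this
    have := μ.1.2
    omega
  · have := hdn κ
    have := congrArg YoungDiagram.card this
    have := κ.1.2
    omega
  · exact Subtype.ext (Subtype.ext (hup μ))
  · exact Subtype.ext (Subtype.ext (hdn κ).symm)

-- Branching rule: deleting the largest entry is a bijection onto the tableaux of the diagrams with
-- one box less.
open Classical in
theorem dimension_eq_sum (n : ℕ) (μ : YoungDiagramOfSize (n + 1)) :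
    μ.1.dimension = ∑ ν : YoungDiagramOfSize n, if ν.1 ≤ μ.1 then ν.1.dimension else 0 := by
  have hc : ∀ ν : YoungDiagramOfSize n, μ.1.card = ν.1.card + 1 := fun ν => by rw [μ.2, ν.2]
  let f : (Σ ν : {ν : YoungDiagramOfSize n // ν.1 ≤ μ.1}, StandardYoungTableau ν.1.1) →
      StandardYoungTableau μ.1 := fun x => x.2.extend x.1.2 (hc x.1.1)
  have hf : Function.Bijective f := by
    constructor
    · rintro ⟨⟨⟨ν, h1⟩, h2⟩, U⟩ ⟨⟨⟨ν', h1'⟩, h2'⟩, U'⟩ he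
      obtain ⟨rfl, h4⟩ := StandardYoungTableau.extend_injective he
      exact congrArg (Sigma.mk _) (eq_of_heq h4)
    · intro T
      obtain ⟨ν, h, hc', U, rfl⟩ := T.exists_eq_extend (by rw [μ.2]; omega)
      exact ⟨⟨⟨⟨ν, by have := μ.2; omega⟩, h⟩, U⟩, rfl⟩
  rw [dimension, ← Fintype.card_of_bijective hf, Fintype.card_sigma, ← Finset.sum_filter,
    ← Finset.sum_subtype_eq_sum_filter]
  simp only [Finset.subtype_univ]
  rfl

theorem card_zero_eq_bot {μ : YoungDiagram} (h : μ.card = 0) : μ = ⊥ :=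
  YoungDiagram.ext (Finset.card_eq_zero.1 h)

instance : Unique (YoungDiagramOfSize 0) where
  default := ⟨⊥, rfl⟩
  uniq μ := Subtype.ext (card_zero_eq_bot μ.2)

instance : Unique (StandardYoungTableau ⊥) where
  default := ⟨fun _ _ => 0, fun _ h => absurd h (notMem_bot _), fun _ h => absurd h (notMem_bot _),
    by simp [YoungDiagram.card], fun _ => rfl⟩
  uniq T := by
    ext i j
    rw [T.zeros (notMem_bot _)]

theorem dimension_bot : (⊥ : YoungDiagram).dimension = 1 := Fintype.card_unique

-- The branching rule makes dimensions stable under going down; commuting up past down then adds one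
-- copy of `d_ν` at each level, which produces the factor by induction.
open Classical in
theorem sum_dimension_upper (n : ℕ) (ν : YoungDiagramOfSize n) :
    (∑ μ : YoungDiagramOfSize (n + 1), if ν.1 ≤ μ.1 then μ.1.dimension else 0) =
      (n + 1) * ν.1.dimension := by
  induction n with
  | zero =>
    obtain rfl := Unique.eq_default ν
    have hb : (default : YoungDiagramOfSize 0).1 = ⊥ := rfl
    have h0 : ∀ μ : YoungDiagramOfSize 1, μ.1.dimension = 1 := fun μ => by
      rw [dimension_eq_sum, Fintype.sum_unique, hb, if_pos bot_le, dimension_bot]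
    have h1 : ∀ μ : YoungDiagramOfSize 1, (0, 0) ∈ μ.1 := fun μ => by
      obtain ⟨c, hc⟩ := Finset.card_pos.1 (show 0 < μ.1.cells.card by
        have : μ.1.cells.card = 1 := μ.2
        omega)
      exact μ.1.up_left_mem (Nat.zero_le c.1) (Nat.zero_le c.2) (by simpa using hc)
    have h2 : ∀ μ : YoungDiagramOfSize 1, μ.1.cells = {(0, 0)} := fun μ =>
      (Finset.eq_of_subset_of_card_le (by simpa using h1 μ)
        (by rw [Finset.card_singleton]; exact μ.2.le)).symm
    let μ₀ : YoungDiagramOfSize 1 := ⟨addBox ⊥ 0 (Or.inl rfl), card_addBox _ _ _⟩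
    have : Unique (YoungDiagramOfSize 1) :=
      ⟨⟨μ₀⟩, fun μ => Subtype.ext (YoungDiagram.ext ((h2 μ).trans (h2 μ₀).symm))⟩
    rw [Fintype.sum_unique, hb, if_pos bot_le, dimension_bot, h0]
  | succ n ih =>
    have key : ∀ ν' : YoungDiagramOfSize (n + 1),
        (∑ μ : YoungDiagramOfSize (n + 2), if ν.1 ≤ μ.1 then
          (if ν'.1 ≤ μ.1 then ν'.1.dimension else 0) else 0) =
        (∑ κ : YoungDiagramOfSize n, if κ.1 ≤ ν.1 then
          (if κ.1 ≤ ν'.1 then ν'.1.dimension else 0) else 0) +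
          if ν' = ν then ν'.1.dimension else 0 := fun ν' => by
      have h := card_common_upper n ν ν'
      rw [Nat.card_eq_fintype_card, Nat.card_eq_fintype_card, Fintype.card_subtype,
        Fintype.card_subtype] at h
      simp only [← ite_and, ← Finset.sum_filter, Finset.sum_const, smul_eq_mul, h, add_mul]
      simp
    calc (∑ μ : YoungDiagramOfSize (n + 2), if ν.1 ≤ μ.1 then μ.1.dimension else 0)
        = ∑ μ : YoungDiagramOfSize (n + 2), ∑ ν' : YoungDiagramOfSize (n + 1),
            if ν.1 ≤ μ.1 then (if ν'.1 ≤ μ.1 then ν'.1.dimension else 0) else 0 := by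
          refine Finset.sum_congr rfl fun μ _ => ?_
          rw [dimension_eq_sum (n + 1) μ]
          split_ifs <;> simp
      _ = ∑ ν' : YoungDiagramOfSize (n + 1), ((∑ κ : YoungDiagramOfSize n, if κ.1 ≤ ν.1 then
          (if κ.1 ≤ ν'.1 then ν'.1.dimension else 0) else 0) +
          if ν' = ν then ν'.1.dimension else 0) := by
          rw [Finset.sum_comm]
          exact Finset.sum_congr rfl fun ν' _ => key ν'
      _ = (∑ κ : YoungDiagramOfSize n, if κ.1 ≤ ν.1 then (n + 1) * κ.1.dimension else 0) +
          ν.1.dimension := by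
          rw [Finset.sum_add_distrib, Finset.sum_comm]
          congr 1
          · refine Finset.sum_congr rfl fun κ _ => ?_
            rw [← ih κ]
            split_ifs <;> simp
          · simp
      _ = (n + 1 + 1) * ν.1.dimension := by
          rw [add_mul, one_mul, dimension_eq_sum n ν, Finset.mul_sum]
          simp

/-- The squares of the dimensions add up to `n!`. -/
theorem sum_dimension_sq (n : ℕ) :
    ∑ μ : YoungDiagramOfSize n, μ.1.dimension * μ.1.dimension = n.factorial := by
  classical
  induction n with
  | zero =>
    rw [Fintype.sum_unique]
    simp [show (default : YoungDiagramOfSize 0).1 = ⊥ from rfl, dimension_bot]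
  | succ n ih =>
    calc ∑ μ : YoungDiagramOfSize (n + 1), μ.1.dimension * μ.1.dimension
        = ∑ μ : YoungDiagramOfSize (n + 1), ∑ ν : YoungDiagramOfSize n,
            ν.1.dimension * if ν.1 ≤ μ.1 then μ.1.dimension else 0 := by
          refine Finset.sum_congr rfl fun μ _ => ?_
          conv_lhs => rw [dimension_eq_sum n μ, Finset.sum_mul]
          refine Finset.sum_congr rfl fun ν _ => ?_
          rw [← dimension_eq_sum n μ]
          split_ifs <;> simp
      _ = ∑ ν : YoungDiagramOfSize n, ν.1.dimension * ((n + 1) * ν.1.dimension) := by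
          rw [Finset.sum_comm]
          refine Finset.sum_congr rfl fun ν _ => ?_
          rw [← Finset.mul_sum, sum_dimension_upper]
      _ = (n + 1).factorial := by
          rw [Nat.factorial_succ, ← ih, Finset.mul_sum]
          exact Finset.sum_congr rfl fun ν _ => by ring

end YoungDiagram

/-! ### Columnwise tableau, tableaux from contents, and connectedness under exchanges. -/

namespace StandardYoungTableau

variable {μ ν : YoungDiagram}

/-- The tableau filled column by column: `col m` is the column of the entry `m + 1`. -/
theorem exists_columnwise (n : ℕ) (μ : YoungDiagram) (hμ : μ.card = n) :
    ∃ (T : StandardYoungTableau μ) (col : Fin n → ℕ), Monotone col ∧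
      (∀ m : Fin n, T.diagonal (m + 1) =
        (col m : ℤ) - ((Finset.univ.filter fun p => p < m ∧ col p = col m).card : ℤ) + 1) ∧
      ∀ b, (Finset.univ.filter fun p => col p = b).card = μ.colLen b := by
  classical
  -- Coordinates are reversed so that the lexicographic order reads column by column, each from top
  -- to bottom.
  let s : Finset (ℕ ×ₗ ℕ) := μ.cells.image fun c => toLex (c.2, c.1)
  have hinj : Function.Injective fun c : ℕ × ℕ => (toLex (c.2, c.1) : ℕ ×ₗ ℕ) := fun a b h => by
    have := toLex.injective h
    simp only [Prod.mk.injEq] at this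
    exact Prod.ext this.2 this.1
  have hs : s.card = n := by rw [Finset.card_image_of_injective _ hinj]; exact hμ
  have hmem : ∀ {i j : ℕ}, (i, j) ∈ μ ↔ toLex (j, i) ∈ s := fun {i j} => by
    simp [s]
  let e : Fin n ≃o s := s.orderIsoOfFin hs
  let box : Fin n → ℕ × ℕ := fun m => ((ofLex (e m).1).2, (ofLex (e m).1).1)
  have hbox : ∀ m, box m ∈ μ := fun m => hmem.2 (e m).2
  have hlt : ∀ {p m : Fin n}, p < m ↔ (box p).2 < (box m).2 ∨
      (box p).2 = (box m).2 ∧ (box p).1 < (box m).1 := fun {p m} => by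
    rw [← e.lt_iff_lt, ← Subtype.coe_lt_coe, Prod.Lex.lt_iff]
  have hboxinj : Function.Injective box := fun p m h => by
    rcases lt_trichotomy p m with h' | h' | h'
    · rw [hlt, h] at h'; omega
    · exact h'
    · rw [hlt, h] at h'; omega
  have hboxsurj : ∀ {i j}, (i, j) ∈ μ → ∃ m, box m = (i, j) := fun {i j} h => by
    obtain ⟨m, hm⟩ := e.surjective ⟨_, hmem.1 h⟩
    exact ⟨m, by simp [box, hm]⟩
  let num : ℕ → ℕ → ℕ := fun i j =>
    if h : (i, j) ∈ μ then ((e.symm ⟨toLex (j, i), hmem.1 h⟩ : Fin n) : ℕ) + 1 else 0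
  have hnum : ∀ m, num (box m).1 (box m).2 = m + 1 := fun m => by
    have : (⟨toLex ((box m).2, (box m).1), hmem.1 (hbox m)⟩ : s) = e m := rfl
    simp only [num]
    rw [dif_pos (hbox m), this, e.symm_apply_apply]
  let T : StandardYoungTableau μ := {
    entry := num
    row_strict := fun {i j₁ j₂} hj hm => by
      obtain ⟨p, hp⟩ := hboxsurj (μ.up_left_mem le_rfl hj.le hm)
      obtain ⟨q, hq⟩ := hboxsurj hm
      have h1 := hnum p
      have h2 := hnum q
      have h3 : p < q := by rw [hlt, hp, hq]; exact Or.inl hj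
      rw [hp] at h1
      rw [hq] at h2
      rw [h1, h2]
      exact Nat.succ_lt_succ h3
    col_strict := fun {i₁ i₂ j} hi hm => by
      obtain ⟨p, hp⟩ := hboxsurj (μ.up_left_mem hi.le le_rfl hm)
      obtain ⟨q, hq⟩ := hboxsurj hm
      have h1 := hnum p
      have h2 := hnum q
      have h3 : p < q := by rw [hlt, hp, hq]; exact Or.inr ⟨rfl, hi⟩
      rw [hp] at h1
      rw [hq] at h2
      rw [h1, h2]
      exact Nat.succ_lt_succ h3
    bijOn := by
      refine ⟨fun x hx => ?_, fun x hx y hy hxy => ?_, fun m hm => ?_⟩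
      · obtain ⟨m, hm : box m = x⟩ := hboxsurj (i := x.1) (j := x.2) (by simpa using hx)
        subst hm
        simp only [hnum, Set.mem_Icc]
        omega
      · obtain ⟨p, hp : box p = x⟩ := hboxsurj (i := x.1) (j := x.2) (by simpa using hx)
        obtain ⟨q, hq : box q = y⟩ := hboxsurj (i := y.1) (j := y.2) (by simpa using hy)
        subst hp hq
        simp only [hnum, add_left_inj, Fin.val_inj] at hxy
        rw [hxy]
      · refine ⟨box ⟨m - 1, by have := hm.1; have := hm.2; omega⟩, by simpa using hbox _, ?_⟩
        simp only [hnum]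
        have := hm.1
        omega
    zeros := fun {i j} h => by simp [num, h] }
  refine ⟨T, fun m => (box m).2, fun p m hpm => ?_, fun m => ?_, fun b => ?_⟩
  · rcases hpm.lt_or_eq with h | rfl
    · rw [hlt] at h
      change (box p).2 ≤ (box m).2
      omega
    · exact le_rfl
  -- The earlier positions in the same column are the boxes above, so their number is the row index.
  · have h1 : (Finset.univ.filter fun p => p < m ∧ (box p).2 = (box m).2).card = (box m).1 := by
      rw [← Finset.card_range (box m).1]
      refine Finset.card_bij (fun p _ => (box p).1) (fun p hp => ?_) (fun p hp q hq h => ?_)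
        (fun i hi => ?_)
      · simp only [Finset.mem_filter, Finset.mem_univ, true_and, hlt] at hp
        rw [Finset.mem_range]; omega
      · simp only [Finset.mem_filter, Finset.mem_univ, true_and] at hp hq
        exact hboxinj (Prod.ext h (hp.2.trans hq.2.symm))
      · rw [Finset.mem_range] at hi
        obtain ⟨p, hp⟩ := hboxsurj (μ.up_left_mem hi.le le_rfl (hbox m))
        refine ⟨p, ?_, by rw [hp]⟩
        simp only [Finset.mem_filter, Finset.mem_univ, true_and, hlt, hp]
        exact ⟨Or.inr ⟨rfl, hi⟩, rfl⟩
    rw [h1, ← T.diagonal_eq (hbox m)]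
    exact congrArg _ (hnum m).symm
  · rw [μ.colLen_eq_card]
    refine Finset.card_bij (fun p _ => box p) (fun p hp => ?_) (fun p _ q _ h => hboxinj h)
      (fun c hc => ?_)
    · rw [Finset.mem_filter] at hp
      exact YoungDiagram.mem_col_iff.2 ⟨hbox p, hp.2⟩
    · rw [YoungDiagram.mem_col_iff] at hc
      obtain ⟨p, hp⟩ := hboxsurj (i := c.1) (j := c.2) hc.1
      exact ⟨p, by simp [hp, hc.2], hp⟩

/-- A standard Young tableau is determined by the contents of its entries. -/
theorem eq_of_diagonal_eq (n : ℕ) (x y : Σ μ : YoungDiagramOfSize n, StandardYoungTableau μ.1)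
    (h : ∀ m, 1 ≤ m → m ≤ n → x.2.diagonal m = y.2.diagonal m) : x = y := by
  induction n with
  | zero =>
    obtain ⟨μ, T⟩ := x
    obtain ⟨μ', T'⟩ := y
    obtain rfl := Unique.eq_default μ
    obtain rfl := Unique.eq_default μ'
    have : Subsingleton (StandardYoungTableau (default : YoungDiagramOfSize 0).1) :=
      inferInstanceAs (Subsingleton (StandardYoungTableau ⊥))
    rw [Subsingleton.elim T T']
  | succ n ih =>
    obtain ⟨⟨μ, hμ⟩, T⟩ := x
    obtain ⟨⟨μ', hμ'⟩, T'⟩ := y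
    change StandardYoungTableau μ at T
    change StandardYoungTableau μ' at T'
    change ∀ m, 1 ≤ m → m ≤ n + 1 → T.diagonal m = T'.diagonal m at h
    obtain ⟨ν, hν, hc, U, rfl⟩ := T.exists_eq_extend (by omega)
    obtain ⟨ν', hν', hc', U', rfl⟩ := T'.exists_eq_extend (by omega)
    simp only [diagonal_extend] at h
    have h1 := ih ⟨⟨ν, by omega⟩, U⟩ ⟨⟨ν', by omega⟩, U'⟩ fun m hm hm' => by
      have := h m hm (by omega)
      rwa [Function.update_of_ne (by omega), Function.update_of_ne (by omega)] at this
    -- The remaining content is that of the box added to the common smaller diagram, and it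
    -- determines that box.
    have h2 := h (n + 1) (by omega) le_rfl
    rw [← hμ, Function.update_self, hμ, ← hμ', Function.update_self] at h2
    obtain rfl : ν = ν' := congrArg (fun z => z.1.1) h1
    obtain rfl : U = U' := by simpa using h1
    obtain rfl := YoungDiagram.eq_of_contentSum_eq hν hc hν' (by omega) (by omega)
    rfl

/-- Any two standard Young tableaux of the same shape are connected by exchanges of consecutive
entries whose contents differ by at least two. -/
theorem diagonal_induction (n : ℕ) (P : (ℕ → ℤ) → Prop)
    (hP : ∀ c k, 1 ≤ k → k + 1 ≤ n → 2 ≤ |c (k + 1) - c k| → P c →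
      P (c ∘ Equiv.swap k (k + 1)))
    (μ : YoungDiagram) (hμ : μ.card = n) (T T' : StandardYoungTableau μ)
    (h : P T.diagonal) : P T'.diagonal := by
  induction n generalizing P μ with
  | zero =>
    obtain rfl := YoungDiagram.card_zero_eq_bot hμ
    rwa [Subsingleton.elim T' T]
  | succ n ih =>
    -- With the largest entry in a fixed box, induction applies to the property with the last
    -- content frozen; since `P` concerns content functions only, the exchanges need not be realised
    -- on tableaux.
    have same : ∀ (ν : YoungDiagram) (hν : ν ≤ μ) (hc : μ.card = ν.card + 1)
        (U U' : StandardYoungTableau ν), P (U.extend hν hc).diagonal →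
          P (U'.extend hν hc).diagonal := by
      intro ν hν hc U U' hU
      rw [diagonal_extend] at hU ⊢
      refine ih (fun c => P (Function.update c μ.card (μ.contentSum - ν.contentSum)))
        (fun c k hk hkn habs hc' => ?_) ν (by omega) U U' hU
      have := hP _ k hk (by omega) (by
        rwa [Function.update_of_ne (by omega), Function.update_of_ne (by omega)]) hc'
      convert this using 1
      ext m
      by_cases hm : m = μ.card
      · subst hm
        rw [Function.update_self, Function.comp_apply,
          Equiv.swap_apply_of_ne_of_ne (by omega) (by omega), Function.update_self]
      · rw [Function.update_of_ne hm, Function.comp_apply, Function.comp_apply,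
          Function.update_of_ne]
        intro heq
        apply hm
        have := congrArg (Equiv.swap k (k + 1)) heq
        rwa [Equiv.swap_apply_self, Equiv.swap_apply_of_ne_of_ne (by omega) (by omega)] at this
    obtain ⟨ν, hν, hc, U, rfl⟩ := T.exists_eq_extend (by omega)
    obtain ⟨ν', hν', hc', U', rfl⟩ := T'.exists_eq_extend (by omega)
    by_cases hne : ν = ν'
    · subst hne
      exact same _ _ _ _ _ h
    -- If the largest entry sits in different corners, both corners are removed. A tableau of `ν ⊓
    -- ν'` extends to `μ` through `ν` or through `ν'`, and the two results differ by exchanging the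
    -- last two entries.
    have hsup : ν ⊔ ν' = μ := by
      refine YoungDiagram.eq_of_le_of_card_le (sup_le hν hν') ?_
      by_contra! hh
      have h1 := YoungDiagram.eq_of_le_of_card_le (le_sup_left (a := ν) (b := ν')) (by omega)
      have h2 := YoungDiagram.eq_of_le_of_card_le (le_sup_right (a := ν) (b := ν')) (by omega)
      exact hne (h1.trans h2.symm)
    have hcard := YoungDiagram.card_sup_add_inf ν ν'
    have hS := YoungDiagram.contentSum_sup_add_inf ν ν'
    rw [hsup] at hcard hS
    have hκ : ν.card = (ν ⊓ ν').card + 1 := by omega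
    have hκ' : ν'.card = (ν ⊓ ν').card + 1 := by omega
    -- Any tableau of this shape would do.
    obtain ⟨W, -⟩ := exists_columnwise _ (ν ⊓ ν') rfl
    have h1 := same ν hν hc U (W.extend inf_le_left hκ) h
    have habs := YoungDiagram.two_le_abs_contentSum_sub hν hc hν' hc' hne
    refine same ν' hν' hc' (W.extend inf_le_right hκ') U' ?_
    simp only [diagonal_extend] at h1 ⊢
    have hk : μ.card = ν.card + 1 := hc
    have hk' : ν'.card = ν.card := by omega
    rw [hk']
    rw [hk] at h1 ⊢
    have h2 := hP _ ν.card (by omega) (by omega) (by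
      rw [Function.update_self, Function.update_of_ne (by omega), Function.update_self]
      rw [le_abs] at habs ⊢
      omega) h1
    convert h2 using 1
    ext m
    rw [Function.comp_apply]
    by_cases hm : m = ν.card
    · subst hm
      rw [Function.update_of_ne (by omega), Function.update_self, Equiv.swap_apply_left,
        Function.update_self]
      omega
    by_cases hm' : m = ν.card + 1
    · subst hm'
      rw [Function.update_self, Equiv.swap_apply_right, Function.update_of_ne (by omega),
        Function.update_self]
      omega
    rw [Equiv.swap_apply_of_ne_of_ne hm hm', Function.update_of_ne hm', Function.update_of_ne hm,
      Function.update_of_ne hm', Function.update_of_ne hm]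

end StandardYoungTableau

/-! ### Joint weights and intertwiners. -/

/-- The vectors `a` and `b` are simultaneously realised as the eigenvalues of the left and of the
right Jucys–Murphy elements on a nonzero function on the symmetric group. -/
def IsJointWeight {n : ℕ} (a b : Fin n → ℝ) : Prop :=
  ∃ f : Equiv.Perm (Fin n) → ℝ, f ≠ 0 ∧
    (∀ j σ, ∑ i ∈ Finset.Iio j, f (Equiv.swap i j * σ) = a j * f σ) ∧
    ∀ j σ, ∑ i ∈ Finset.Iio j, f (σ * Equiv.swap i j) = b j * f σ

namespace IsJointWeight

variable {n : ℕ} {a b : Fin n → ℝ}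

theorem symm (h : IsJointWeight a b) : IsJointWeight b a := by
  obtain ⟨f, hf, hl, hr⟩ := h
  refine ⟨fun σ => f σ⁻¹, fun h0 => hf ?_, fun j σ => ?_, fun j σ => ?_⟩
  · ext σ
    simpa using congrFun h0 σ⁻¹
  · simpa [mul_inv_rev] using hr j σ⁻¹
  · simpa [mul_inv_rev] using hl j σ⁻¹

/-- Let `s = (k k')` and `g(σ) = f(sσ)`. Conjugation by `s` gives `J_{k'} g = a_k g + f` and `J_k g
= a_{k'} g - f`, so `g - (a_{k'} - a_k)⁻¹ f` is an eigenfunction with the two values exchanged.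
Right multiplications commute with `s`, so `b` is unchanged. -/
theorem comp_swap (h : IsJointWeight a b) {k k' : Fin n} (hk : (k' : ℕ) = k + 1)
    (h0 : a k' - a k ≠ 0) (h1 : (a k' - a k) ^ 2 ≠ 1) :
    IsJointWeight (a ∘ Equiv.swap k k') b := by
  obtain ⟨f, hf, hl, hr⟩ := h
  have hkk : k ≠ k' := fun h => by rw [h] at hk; omega
  have hIio : Finset.Iio k' = insert k (Finset.Iio k) := by
    ext i
    simp only [Finset.mem_Iio, Finset.mem_insert, Fin.lt_def, Fin.ext_iff]
    omega
  have hcomm : ∀ i j σ, f (Equiv.swap k k' * (Equiv.swap i j * σ)) =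
      f (Equiv.swap (Equiv.swap k k' i) (Equiv.swap k k' j) * (Equiv.swap k k' * σ)) :=
    fun i j σ => by rw [← mul_assoc, Equiv.mul_swap_eq_swap_mul, mul_assoc]
  have hss : ∀ σ, Equiv.swap k k' * (Equiv.swap k k' * σ) = σ := fun σ => by
    rw [← mul_assoc, Equiv.swap_mul_self, one_mul]
  have hfix : ∀ i ∈ Finset.Iio k, Equiv.swap k k' i = i := fun i hi => by
    rw [Finset.mem_Iio, Fin.lt_def] at hi
    refine Equiv.swap_apply_of_ne_of_ne ?_ ?_ <;> rw [Ne, Fin.ext_iff] <;> omega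
  have hup : ∀ σ, ∑ i ∈ Finset.Iio k', f (Equiv.swap k k' * (Equiv.swap i k' * σ)) =
      a k * f (Equiv.swap k k' * σ) + f σ := fun σ => by
    rw [hIio, Finset.sum_insert (by simp), hss, ← hl k, add_comm]
    congr 1
    refine Finset.sum_congr rfl fun i hi => ?_
    rw [hcomm, hfix i hi, Equiv.swap_apply_right]
  have hdown : ∀ σ, ∑ i ∈ Finset.Iio k, f (Equiv.swap k k' * (Equiv.swap i k * σ)) =
      a k' * f (Equiv.swap k k' * σ) - f σ := fun σ => by
    rw [← hl k', hIio, Finset.sum_insert (by simp), hss, add_sub_cancel_left]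
    refine Finset.sum_congr rfl fun i hi => ?_
    rw [hcomm, hfix i hi, Equiv.swap_apply_left]
  have hother : ∀ j, j ≠ k → j ≠ k' → ∀ σ,
      ∑ i ∈ Finset.Iio j, f (Equiv.swap k k' * (Equiv.swap i j * σ)) =
        a j * f (Equiv.swap k k' * σ) := fun j hj hj' σ => by
    rw [← hl j]
    -- As `k` and `k'` are consecutive and differ from `j`, both or neither lie below `j`.
    have hmem : ∀ i ∈ Finset.Iio j, Equiv.swap k k' i ∈ Finset.Iio j := fun i hi => by
      rw [Finset.mem_Iio, Fin.lt_def] at hi ⊢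
      rw [Ne, Fin.ext_iff] at hj hj'
      rw [Equiv.swap_apply_def]
      split_ifs with h1 h2
      · subst h1; omega
      · subst h2; omega
      · exact hi
    refine Finset.sum_bij' (fun i _ => Equiv.swap k k' i) (fun i _ => Equiv.swap k k' i)
      hmem hmem (fun i _ => Equiv.swap_apply_self _ _ _) (fun i _ => Equiv.swap_apply_self _ _ _)
      fun i _ => ?_
    rw [hcomm, Equiv.swap_apply_of_ne_of_ne hj hj']
  refine ⟨fun σ => f (Equiv.swap k k' * σ) - (a k' - a k)⁻¹ * f σ, fun hz => hf ?_,
    fun j σ => ?_, fun j σ => ?_⟩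
  -- If the new function vanished, `f` would be an eigenfunction of the involution `s` with
  -- eigenvalue `(a k' - a k)⁻¹`, whose square would then be one.
  · have hz' : ∀ σ, f (Equiv.swap k k' * σ) = (a k' - a k)⁻¹ * f σ := fun σ =>
      sub_eq_zero.1 (congrFun hz σ)
    ext σ
    by_contra hne
    have h2 := hz' (Equiv.swap k k' * σ)
    rw [hss, hz' σ] at h2
    refine h1 (mul_right_cancel₀ hne ?_)
    rw [one_mul]
    nth_rewrite 1 [h2]
    field_simp
  · simp only [Finset.sum_sub_distrib, ← Finset.mul_sum, hl, Function.comp_apply]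
    by_cases hj : j = k
    · subst hj
      rw [hdown, Equiv.swap_apply_left]
      field_simp
      ring
    by_cases hj' : j = k'
    · subst hj'
      rw [hup, Equiv.swap_apply_right]
      field_simp
      ring
    rw [hother j hj hj', Equiv.swap_apply_of_ne_of_ne hj hj']
    ring
  · have := hr j (Equiv.swap k k' * σ)
    simp only [mul_assoc] at this
    simp only [Finset.sum_sub_distrib, ← Finset.mul_sum, hr, this]
    ring

end IsJointWeight

/-! ### Specht polynomials as eigenfunctions, by Lagrange interpolation. -/

section Vandermonde

variable {n : ℕ}

/-- The Vandermonde product of `x` over the positions in `B`. -/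
def vandermondeProd (B : Finset (Fin n)) (x : Fin n → ℝ) : ℝ :=
  ∏ p ∈ B, ∏ q ∈ B, if p < q then x q - x p else 1

/-- The sign of a pair of positions. -/
def pairSign (i k : Fin n) : ℝ := if i < k then -1 else 1

theorem vandermondeProd_congr {B : Finset (Fin n)} {x y : Fin n → ℝ} (h : ∀ i ∈ B, x i = y i) :
    vandermondeProd B x = vandermondeProd B y :=
  Finset.prod_congr rfl fun p hp => Finset.prod_congr rfl fun q hq => by rw [h p hp, h q hq]

theorem vandermondeProd_ne_zero (B : Finset (Fin n)) {x : Fin n → ℝ} (hx : Function.Injective x) :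
    vandermondeProd B x ≠ 0 := by
  refine Finset.prod_ne_zero_iff.2 fun p _ => Finset.prod_ne_zero_iff.2 fun q _ => ?_
  split_ifs with h
  · exact sub_ne_zero.2 (hx.ne h.ne')
  · exact one_ne_zero

/-- Isolates the dependence on `x i`. The sign depends on positions only, so it cancels when `x` is
compared with a permuted `x`. -/
theorem vandermondeProd_insert {B : Finset (Fin n)} {i : Fin n} (hi : i ∉ B) (x : Fin n → ℝ) :
    vandermondeProd (insert i B) x =
      (∏ k ∈ B, pairSign i k) * (∏ k ∈ B, (x i - x k)) * vandermondeProd B x := by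
  have h : ∀ k ∈ B, (if i < k then x k - x i else 1) * (if k < i then x i - x k else 1) =
      pairSign i k * (x i - x k) := fun k hk => by
    rcases lt_trichotomy i k with h | rfl | h
    · simp [pairSign, h, h.not_gt]
    · exact absurd hk hi
    · simp [pairSign, h, h.not_gt]
  have h' : ∀ p ∈ B, (∏ q ∈ insert i B, if p < q then x q - x p else 1) =
      (if p < i then x i - x p else 1) * ∏ q ∈ B, if p < q then x q - x p else 1 :=
    fun p _ => Finset.prod_insert hi
  rw [vandermondeProd, Finset.prod_insert hi, Finset.prod_insert hi, if_neg (lt_irrefl i), one_mul,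
    Finset.prod_congr rfl h', Finset.prod_mul_distrib, ← mul_assoc, ← Finset.prod_mul_distrib,
    Finset.prod_congr rfl h, Finset.prod_mul_distrib, vandermondeProd]

theorem vandermondeProd_eq_erase {B : Finset (Fin n)} {i : Fin n} (hi : i ∈ B) (x : Fin n → ℝ) :
    vandermondeProd B x = (∏ k ∈ B.erase i, pairSign i k) * (∏ k ∈ B.erase i, (x i - x k)) *
      vandermondeProd (B.erase i) x := by
  conv_lhs => rw [← Finset.insert_erase hi]
  exact vandermondeProd_insert (Finset.notMem_erase i B) x

theorem vandermondeProd_comp_swap {B : Finset (Fin n)} {i j : Fin n} (hi : i ∈ B) (hj : j ∈ B)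
    (hij : i ≠ j) (x : Fin n → ℝ) :
    vandermondeProd B (x ∘ Equiv.swap i j) = -vandermondeProd B x := by
  have hj' : j ∈ B.erase i := Finset.mem_erase.2 ⟨hij.symm, hj⟩
  have hfix : ∀ k ∈ (B.erase i).erase j, (x ∘ Equiv.swap i j) k = x k := fun k hk => by
    rw [Finset.mem_erase, Finset.mem_erase] at hk
    rw [Function.comp_apply, Equiv.swap_apply_of_ne_of_ne hk.2.1 hk.1]
  have expand : ∀ y : Fin n → ℝ, ∏ k ∈ B.erase i, (y i - y k) =
      (y i - y j) * ∏ k ∈ (B.erase i).erase j, (y i - y k) := fun y =>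
    (Finset.mul_prod_erase _ _ hj').symm
  have hprod : ∀ u : Fin n, ∏ k ∈ (B.erase i).erase j, (x u - (x ∘ Equiv.swap i j) k) =
      ∏ k ∈ (B.erase i).erase j, (x u - x k) := fun u =>
    Finset.prod_congr rfl fun k hk => by rw [hfix k hk]
  rw [vandermondeProd_eq_erase hi, vandermondeProd_eq_erase hj', vandermondeProd_eq_erase hi x,
    vandermondeProd_eq_erase hj' x, vandermondeProd_congr hfix, expand, expand]
  have h1 : (x ∘ Equiv.swap i j) i = x j := by simp
  have h2 : (x ∘ Equiv.swap i j) j = x i := by simp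
  rw [h1, h2, hprod, hprod]
  ring

/-- Lagrange interpolation of `g` at the nodes `x i`, evaluated at `t`. -/
theorem sum_eval_mul_prod_div (B : Finset (Fin n)) {x : Fin n → ℝ} (hx : Function.Injective x)
    (g : ℝ[X]) (hg : g.degree < B.card) (t : ℝ) :
    ∑ i ∈ B, g.eval (x i) * ∏ k ∈ B.erase i, ((t - x k) / (x i - x k)) = g.eval t := by
  conv_rhs => rw [Lagrange.eq_interpolate (s := B) (v := x) hx.injOn hg]
  rw [Lagrange.interpolate_apply, eval_finsetSum]
  refine Finset.sum_congr rfl fun i _ => ?_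
  rw [eval_mul, eval_C, Lagrange.basis, eval_prod]
  congr 1
  refine Finset.prod_congr rfl fun k _ => ?_
  rw [Lagrange.basisDivisor, eval_mul, eval_C, eval_sub, eval_X, eval_C, div_eq_inv_mul]

/-- The product of the Vandermonde products over the fibres of `col`. -/
def columnProd (col : Fin n → ℕ) (x : Fin n → ℝ) : ℝ :=
  ∏ b ∈ Finset.univ.image col, vandermondeProd (Finset.univ.filter fun p => col p = b) x

theorem columnProd_ne_zero (col : Fin n → ℕ) {x : Fin n → ℝ} (hx : Function.Injective x) :
    columnProd col x ≠ 0 :=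
  Finset.prod_ne_zero_iff.2 fun _ _ => vandermondeProd_ne_zero _ hx

theorem columnProd_comp_swap_of_eq (col : Fin n → ℕ) {i j : Fin n} (hij : i ≠ j)
    (hcol : col i = col j) (x : Fin n → ℝ) :
    columnProd col (x ∘ Equiv.swap i j) = -columnProd col x := by
  have hm : col j ∈ Finset.univ.image col := Finset.mem_image_of_mem _ (Finset.mem_univ _)
  rw [columnProd, columnProd, ← Finset.mul_prod_erase _ _ hm, ← Finset.mul_prod_erase _ _ hm,
    vandermondeProd_comp_swap (by simpa using hcol) (by simp) hij, neg_mul]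
  congr 2
  refine Finset.prod_congr rfl fun b hb => vandermondeProd_congr fun k hk => ?_
  have hb' := (Finset.mem_erase.1 hb).1
  have hk' : col k = b := by simpa using hk
  rw [Function.comp_apply, Equiv.swap_apply_of_ne_of_ne]
  · rintro rfl; exact hb' (hk'.symm.trans hcol)
  · rintro rfl; exact hb' hk'.symm

/-- A Garnir relation. After exchanging `i` and `j`, the column of `j` contributes `g (x i)` with `g
= ∏ (X - x k)` over its other positions, and column `b` contributes the Lagrange basis polynomial of
`i` evaluated at `x j`. Since `g` has degree below the length of column `b`, the sum interpolates to
`g (x j)`, the original factor. -/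
theorem sum_columnProd_comp_swap (col : Fin n → ℕ) {b : ℕ} {j : Fin n} (hb : b ≠ col j)
    (hcard : (Finset.univ.filter fun p => col p = col j).card ≤
      (Finset.univ.filter fun p => col p = b).card) {x : Fin n → ℝ} (hx : Function.Injective x) :
    ∑ i ∈ Finset.univ.filter (fun p => col p = b), columnProd col (x ∘ Equiv.swap i j) =
      columnProd col x := by
  set B := Finset.univ.filter fun p => col p = b with hB
  set C := Finset.univ.filter fun p => col p = col j with hC
  have hjC : j ∈ C := by simp [hC]
  have hm : col j ∈ Finset.univ.image col := Finset.mem_image_of_mem _ (Finset.mem_univ _)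
  have hBne : B.Nonempty := Finset.card_pos.1 ((Finset.card_pos.2 ⟨j, hjC⟩).trans_le hcard)
  have hm' : b ∈ (Finset.univ.image col).erase (col j) := by
    obtain ⟨p, hp⟩ := hBne
    have : col p = b := by simpa [hB] using hp
    exact Finset.mem_erase.2 ⟨hb, this ▸ Finset.mem_image_of_mem _ (Finset.mem_univ _)⟩
  have hsplit : ∀ y, columnProd col y = vandermondeProd C y * (vandermondeProd B y *
      ∏ d ∈ ((Finset.univ.image col).erase (col j)).erase b,
        vandermondeProd (Finset.univ.filter fun p => col p = d) y) := fun y => by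
    rw [columnProd, ← Finset.mul_prod_erase _ _ hm, ← Finset.mul_prod_erase _ _ hm']
  let g : ℝ[X] := ∏ k ∈ C.erase j, (X - Polynomial.C (x k))
  have hg : g.degree < B.card := by
    rw [degree_prod_of_monic _ _ fun k _ => monic_X_sub_C _]
    simp only [degree_X_sub_C, Finset.sum_const, nsmul_eq_mul, mul_one, Nat.cast_lt]
    rw [Finset.card_erase_of_mem hjC]
    have := Finset.card_pos.2 ⟨j, hjC⟩
    omega
  have hgeval : ∀ t, g.eval t = ∏ k ∈ C.erase j, (t - x k) := fun t => by
    simp [g, eval_prod]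
  set K := (∏ k ∈ C.erase j, pairSign j k) * vandermondeProd (C.erase j) x * vandermondeProd B x *
      ∏ d ∈ ((Finset.univ.image col).erase (col j)).erase b,
        vandermondeProd (Finset.univ.filter fun p => col p = d) x with hK
  have hterm : ∀ i ∈ B, columnProd col (x ∘ Equiv.swap i j) =
      K * (g.eval (x i) * ∏ k ∈ B.erase i, ((x j - x k) / (x i - x k))) := by
    intro i hi
    have hib : col i = b := by simpa [hB] using hi
    have hfix : ∀ k, k ≠ i → k ≠ j → (x ∘ Equiv.swap i j) k = x k := fun k h1 h2 => by
      rw [Function.comp_apply, Equiv.swap_apply_of_ne_of_ne h1 h2]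
    have h1 : (x ∘ Equiv.swap i j) i = x j := by simp
    have h2 : (x ∘ Equiv.swap i j) j = x i := by simp
    have hfixC : ∀ k ∈ C.erase j, (x ∘ Equiv.swap i j) k = x k := fun k hk => by
      rw [Finset.mem_erase] at hk
      refine hfix k ?_ hk.1
      rintro rfl
      exact hb (hib.symm.trans (by simpa [hC] using hk.2))
    have hfixB : ∀ k ∈ B.erase i, (x ∘ Equiv.swap i j) k = x k := fun k hk => by
      rw [Finset.mem_erase] at hk
      refine hfix k hk.1 fun hkj => ?_
      have h5 : col k = b := by simpa [hB] using hk.2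
      exact hb (hkj ▸ h5.symm)
    have hVC : vandermondeProd C (x ∘ Equiv.swap i j) = (∏ k ∈ C.erase j, pairSign j k) *
        g.eval (x i) * vandermondeProd (C.erase j) x := by
      rw [vandermondeProd_eq_erase hjC, vandermondeProd_congr hfixC, h2, hgeval]
      congr 2
      exact Finset.prod_congr rfl fun k hk => by rw [hfixC k hk]
    have hVB : vandermondeProd B (x ∘ Equiv.swap i j) =
        vandermondeProd B x * ∏ k ∈ B.erase i, ((x j - x k) / (x i - x k)) := by
      have hne : ∏ k ∈ B.erase i, (x i - x k) ≠ 0 := Finset.prod_ne_zero_iff.2 fun k hk =>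
        sub_ne_zero.2 (hx.ne (Finset.mem_erase.1 hk).1.symm)
      have h3 : ∏ k ∈ B.erase i, (x j - (x ∘ Equiv.swap i j) k) =
          ∏ k ∈ B.erase i, (x j - x k) :=
        Finset.prod_congr rfl fun k hk => by rw [hfixB k hk]
      rw [vandermondeProd_eq_erase hi, vandermondeProd_eq_erase hi x, vandermondeProd_congr hfixB,
        h1, h3, Finset.prod_div_distrib]
      field_simp
    have hrest : ∏ d ∈ ((Finset.univ.image col).erase (col j)).erase b,
        vandermondeProd (Finset.univ.filter fun p => col p = d) (x ∘ Equiv.swap i j) =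
        ∏ d ∈ ((Finset.univ.image col).erase (col j)).erase b,
        vandermondeProd (Finset.univ.filter fun p => col p = d) x := by
      refine Finset.prod_congr rfl fun d hd => vandermondeProd_congr fun k hk => ?_
      rw [Finset.mem_erase, Finset.mem_erase] at hd
      have hk' : col k = d := by simpa using hk
      refine hfix k ?_ ?_
      · rintro rfl; exact hd.1 (hk'.symm.trans hib)
      · rintro rfl; exact hd.2.1 hk'.symm
    rw [hsplit, hVC, hVB, hrest, hK]
    ring
  rw [Finset.sum_congr rfl hterm, ← Finset.mul_sum, sum_eval_mul_prod_div B hx g hg, hsplit,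
    vandermondeProd_eq_erase hjC, hgeval, hK]
  ring

/-- The Specht polynomial of the columnwise filling is an eigenfunction of the Jucys–Murphy
elements. -/
theorem sum_Iio_columnProd_comp_swap {col : Fin n → ℕ} (hmono : Monotone col)
    (hanti : ∀ b c, b ≤ c → (Finset.univ.filter fun p => col p = c).card ≤
      (Finset.univ.filter fun p => col p = b).card) {x : Fin n → ℝ} (hx : Function.Injective x)
    (j : Fin n) :
    ∑ i ∈ Finset.Iio j, columnProd col (x ∘ Equiv.swap i j) =
      ((col j : ℝ) - ((Finset.univ.filter fun p => p < j ∧ col p = col j).card : ℝ)) *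
        columnProd col x := by
  rw [← Finset.sum_filter_add_sum_filter_not _ (fun i => col i = col j)]
  have h1 : (Finset.Iio j).filter (fun i => col i = col j) =
      Finset.univ.filter fun p => p < j ∧ col p = col j := by
    ext i; simp
  have h2 : (Finset.Iio j).filter (fun i => ¬ col i = col j) =
      Finset.univ.filter fun p => col p < col j := by
    ext i
    simp only [Finset.mem_filter, Finset.mem_Iio, Finset.mem_univ, true_and]
    constructor
    · rintro ⟨h, h'⟩
      exact lt_of_le_of_ne (hmono h.le) h'
    · intro h
      exact ⟨lt_of_not_ge fun hh => absurd (hmono hh) (not_le.2 h), h.ne⟩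
  -- Each of the `col j` columns to the left is at least as long as that of `j` and contributes one
  -- copy; exchanges within the column, treated next, contribute one sign each.
  have h3 : ∑ i ∈ Finset.univ.filter (fun p => col p < col j),
      columnProd col (x ∘ Equiv.swap i j) = col j * columnProd col x := by
    rw [← Finset.sum_fiberwise_of_maps_to (t := Finset.range (col j)) (g := col)
      fun i hi => by simpa using hi]
    have : ∀ b ∈ Finset.range (col j), ∑ i ∈ (Finset.univ.filter fun p => col p < col j) with
        col i = b, columnProd col (x ∘ Equiv.swap i j) = columnProd col x := fun b hb => by
      rw [Finset.mem_range] at hb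
      rw [← sum_columnProd_comp_swap col hb.ne (hanti b (col j) hb.le) hx]
      refine Finset.sum_congr ?_ fun _ _ => rfl
      ext i
      simp only [Finset.mem_filter, Finset.mem_univ, true_and]
      omega
    rw [Finset.sum_congr rfl this, Finset.sum_const, Finset.card_range, nsmul_eq_mul]
  have h4 : ∑ i ∈ Finset.univ.filter (fun p => p < j ∧ col p = col j),
      columnProd col (x ∘ Equiv.swap i j) =
      -((Finset.univ.filter fun p => p < j ∧ col p = col j).card : ℝ) * columnProd col x := by
    rw [Finset.sum_congr rfl fun i hi => columnProd_comp_swap_of_eq col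
      (Finset.mem_filter.1 hi).2.1.ne (Finset.mem_filter.1 hi).2.2 x]
    rw [Finset.sum_const, nsmul_eq_mul]
    ring
  rw [h1, h2, h3, h4]
  ring

end Vandermonde

/-- An eigenfunction of the right Jucys–Murphy elements yields, by correlation with itself, a
joint eigenfunction with the same eigenvalues on both sides. -/
theorem isJointWeight_self {n : ℕ} {a : Fin n → ℝ} (f : Equiv.Perm (Fin n) → ℝ) (hf : f ≠ 0)
    (h : ∀ j σ, ∑ i ∈ Finset.Iio j, f (σ * Equiv.swap i j) = a j * f σ) : IsJointWeight a a := by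
  refine ⟨fun σ => ∑ τ, f (τ * σ) * f τ, fun h0 => hf ?_, fun j σ => ?_, fun j σ => ?_⟩
  -- The autocorrelation at the identity is a sum of squares.
  · have h1 : ∑ τ, f τ * f τ = 0 := by simpa using congrFun h0 1
    rw [Finset.sum_eq_zero_iff_of_nonneg fun τ _ => mul_self_nonneg (f τ)] at h1
    ext τ
    simpa using h1 τ (Finset.mem_univ τ)
  -- Translating `τ` by the transposition moves it to the second factor, where it acts on the right.
  · have h1 : ∀ i, ∑ τ, f (τ * (Equiv.swap i j * σ)) * f τ =
        ∑ τ, f (τ * σ) * f (τ * Equiv.swap i j) := fun i => by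
      rw [← Equiv.sum_comp (Equiv.mulRight (Equiv.swap i j))]
      refine Finset.sum_congr rfl fun τ _ => ?_
      rw [Equiv.coe_mulRight, mul_assoc, ← mul_assoc (Equiv.swap i j), Equiv.swap_mul_self, one_mul]
    simp only [h1]
    rw [Finset.sum_comm, Finset.mul_sum]
    refine Finset.sum_congr rfl fun τ _ => ?_
    rw [← Finset.mul_sum, h]
    ring
  · rw [Finset.sum_comm, Finset.mul_sum]
    refine Finset.sum_congr rfl fun τ _ => ?_
    simp only [← mul_assoc]
    rw [← Finset.sum_mul, h]

/-! ### Every pair of tableaux of equal shape is a joint weight. -/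

namespace StandardYoungTableau

/-- The contents `j - i` of the boxes of `T`, in the order of the entries. -/
def weight {μ : YoungDiagram} (T : StandardYoungTableau μ) (n : ℕ) (m : Fin n) : ℝ :=
  (T.diagonal (m + 1) : ℝ) - 1

/-- The Specht polynomial is evaluated at the point `(σ i)`, whose coordinates are distinct; right
multiplication of `σ` by a transposition permutes the coordinates. -/
theorem exists_isJointWeight_self (n : ℕ) (μ : YoungDiagram) (hμ : μ.card = n) :
    ∃ T : StandardYoungTableau μ, IsJointWeight (T.weight n) (T.weight n) := by
  obtain ⟨T, col, hmono, hdiag, hcard⟩ := exists_columnwise n μ hμ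
  have hinj : ∀ σ : Equiv.Perm (Fin n), Function.Injective fun i => ((σ i : ℕ) : ℝ) :=
    fun σ p q h => σ.injective (Fin.ext (Nat.cast_injective h))
  refine ⟨T, isJointWeight_self (fun σ => columnProd col fun i => ((σ i : ℕ) : ℝ))
    (fun h0 => columnProd_ne_zero col (hinj 1) (congrFun h0 1)) fun j σ => ?_⟩
  have h := sum_Iio_columnProd_comp_swap hmono
    (fun b c hbc => by rw [hcard, hcard]; exact μ.colLen_anti b c hbc) (hinj σ) j
  rw [weight, hdiag]
  push_cast
  rw [add_sub_cancel_right]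
  exact h

theorem isJointWeight_left (n : ℕ) (μ : YoungDiagram) (hμ : μ.card = n)
    (T T' : StandardYoungTableau μ) (b : Fin n → ℝ) (h : IsJointWeight (T.weight n) b) :
    IsJointWeight (T'.weight n) b := by
  refine diagonal_induction n
    (fun c => IsJointWeight (fun m : Fin n => (c (m + 1) : ℝ) - 1) b) ?_ μ hμ T T' h
  intro c k hk hkn habs hc
  have h1 : (c (k + 1) : ℝ) - 1 - ((c k : ℝ) - 1) = ((c (k + 1) - c k : ℤ) : ℝ) := by
    push_cast; ring
  have h2 : ((⟨k - 1, by omega⟩ : Fin n) : ℕ) + 1 = k := Nat.sub_add_cancel hk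
  -- Entry `k` is position `k - 1` of `Fin n`; contents at distance at least two have a difference
  -- that is neither zero nor `±1`.
  have := hc.comp_swap (k := ⟨k - 1, by omega⟩) (k' := ⟨k, by omega⟩) h2.symm
    (by
      simp only [h2, h1]
      intro h0
      rw [Int.cast_eq_zero] at h0
      rw [h0] at habs
      norm_num at habs)
    (by
      simp only [h2, h1]
      intro h0
      have h3 : (c (k + 1) - c k) ^ 2 = 1 := by exact_mod_cast h0
      rcases sq_eq_one_iff.1 h3 with h4 | h4 <;> rw [h4] at habs <;> norm_num at habs)
  convert this using 1
  ext m
  simp only [Function.comp_apply]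
  congr 3
  by_cases hm : m = ⟨k - 1, by omega⟩
  · subst hm
    simp only [h2, Equiv.swap_apply_left]
  by_cases hm' : m = ⟨k, by omega⟩
  · subst hm'
    simp only [h2, Equiv.swap_apply_right]
  rw [Equiv.swap_apply_of_ne_of_ne hm hm']
  rw [Fin.ext_iff] at hm hm'
  simp only at hm hm'
  rw [Equiv.swap_apply_of_ne_of_ne (by omega) (by omega)]

theorem isJointWeight (n : ℕ) (μ : YoungDiagram) (hμ : μ.card = n)
    (S T : StandardYoungTableau μ) : IsJointWeight (S.weight n) (T.weight n) := by
  obtain ⟨T₀, h⟩ := exists_isJointWeight_self n μ hμ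
  exact isJointWeight_left n μ hμ T₀ S _ (isJointWeight_left n μ hμ T₀ T _ h).symm

end StandardYoungTableau

/-! ### Linear independence, the eigenbasis and the spectrum of the shuffle. -/

/-- Joint eigenvectors with pairwise different systems of eigenvalues are linearly independent. -/
theorem linearIndependent_of_joint_eigenvectors {ι κ V : Type*} [AddCommGroup V] [Module ℝ V]
    (A : κ → Module.End ℝ V) (χ : ι → κ → ℝ) (hχ : Function.Injective χ) (v : ι → V)
    (hv : ∀ i, v i ≠ 0) (hA : ∀ i k, A k (v i) = χ i k • v i) : LinearIndependent ℝ v := by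
  classical
  rw [linearIndependent_iff']
  intro s
  induction s using Finset.induction_on with
  | empty => simp
  | insert i₀ s hi₀ ih =>
    intro g hg
    rw [Finset.sum_insert hi₀] at hg
    have hs : ∀ i ∈ s, g i = 0 := by
      intro i hi
      obtain ⟨k, hk⟩ : ∃ k, χ i k ≠ χ i₀ k := by
        by_contra! h
        exact hi₀ (hχ (funext h) ▸ hi)
      -- Applying `A k - χ i₀ k` to the relation removes the term of `i₀`.
      have h1 : ∑ i ∈ s, (g i * (χ i k - χ i₀ k)) • v i = 0 := by
        have h2 := congrArg (fun u => A k u - χ i₀ k • u) hg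
        simp only [map_add, map_sum, map_smul, hA, smul_add, map_zero, smul_zero, sub_zero,
          Finset.smul_sum] at h2
        rw [smul_comm, add_sub_add_left_eq_sub, ← Finset.sum_sub_distrib] at h2
        rw [← h2]
        refine Finset.sum_congr rfl fun i _ => ?_
        module
      exact (mul_eq_zero.1 (ih _ h1 i hi)).resolve_right (sub_ne_zero.2 hk)
    rw [Finset.sum_eq_zero fun i hi => by rw [hs i hi, zero_smul], add_zero] at hg
    intro i hi
    rcases Finset.mem_insert.1 hi with rfl | hi
    · exact (smul_eq_zero.1 hg).resolve_right (hv _)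
    · exact hs i hi

namespace StandardYoungTableau

theorem eig_eq_sum {μ : YoungDiagram} (w : ℕ → ℝ) (n : ℕ) (hμ : μ.card = n)
    (T : StandardYoungTableau μ) :
    T.eig w = 1 / cumulativeWeight w n *
      ∑ m ∈ Finset.Icc 1 n, (T.diagonal m : ℝ) * (w m / (m : ℝ)) := by
  subst hμ
  rw [eig]
  congr 1
  refine Finset.sum_bij (fun c _ => T.entry c.1 c.2) (fun c hc => ?_) (fun c hc c' hc' h => ?_)
    (fun m hm => ?_) (fun c hc => ?_)
  · rw [Finset.mem_Icc]
    exact T.entry_mem_Icc (by simpa using hc)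
  · exact T.bijOn.injOn (by simpa using hc) (by simpa using hc') h
  · rw [Finset.mem_Icc] at hm
    obtain ⟨c, hc, h⟩ := T.bijOn.surjOn (show m ∈ Set.Icc 1 μ.card from hm)
    exact ⟨c, by simpa using hc, h⟩
  · rw [T.diagonal_eq (i := c.1) (j := c.2) (by simpa using hc)]
    push_cast
    ring

end StandardYoungTableau

/-- The choice `i = j` is the identity and yields the separate term `f σ`; the choices `i < j` form
a left Jucys–Murphy sum. -/
theorem biasedShuffle_mulVec (w : ℕ → ℝ) (n : ℕ) (f : Equiv.Perm (Fin n) → ℝ)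
    (σ : Equiv.Perm (Fin n)) :
    (biasedShuffle w n).mulVec f σ = ∑ j : Fin n,
      w ((j : ℕ) + 1) / cumulativeWeight w n * (1 / (((j : ℕ) + 1 : ℕ) : ℝ)) *
        (f σ + ∑ i ∈ Finset.Iio j, f (Equiv.swap i j * σ)) := by
  rw [Matrix.mulVec, dotProduct, ← Equiv.sum_comp (Equiv.mulRight σ)]
  simp only [biasedShuffle, Matrix.of_apply, Equiv.coe_mulRight, mul_inv_cancel_right, biasedLaw,
    Finset.sum_mul]
  rw [Finset.sum_comm]
  refine Finset.sum_congr rfl fun j _ => ?_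
  rw [Finset.sum_comm, ← Finset.Iio_insert, Finset.sum_insert (by simp), mul_add,
    Finset.mul_sum]
  simp only [ite_mul, zero_mul, Finset.sum_ite_eq', Finset.mem_univ, if_true,
    Equiv.swap_self]
  rfl

/-- The pairs of standard Young tableaux of size `n` of the same shape. -/
abbrev TableauPair (n : ℕ) : Type :=
  Σ μ : YoungDiagramOfSize n, StandardYoungTableau μ.1 × StandardYoungTableau μ.1

theorem card_tableauPair (n : ℕ) : Fintype.card (TableauPair n) = n.factorial := by
  rw [Fintype.card_sigma, ← YoungDiagram.sum_dimension_sq]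
  simp only [Fintype.card_prod, YoungDiagram.dimension]

/-- The symmetric group has a basis of functions, indexed by the pairs of tableaux of equal shape,
on which the left Jucys–Murphy elements act by the contents of the first tableau. -/
theorem exists_basis_jucysMurphy (n : ℕ) :
    ∃ b : Module.Basis (TableauPair n) ℝ (Equiv.Perm (Fin n) → ℝ), ∀ x j σ,
      ∑ i ∈ Finset.Iio j, b x (Equiv.swap i j * σ) = x.2.1.weight n j * b x σ := by
  have h : ∀ x : TableauPair n, IsJointWeight (x.2.1.weight n) (x.2.2.weight n) := fun x =>
    StandardYoungTableau.isJointWeight n x.1.1 x.1.2 x.2.1 x.2.2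
  choose v hv hl hr using h
  let A : Fin n ⊕ Fin n → Module.End ℝ (Equiv.Perm (Fin n) → ℝ) := Sum.elim
    (fun j => ∑ i ∈ Finset.Iio j, LinearMap.funLeft ℝ ℝ fun σ => Equiv.swap i j * σ)
    (fun j => ∑ i ∈ Finset.Iio j, LinearMap.funLeft ℝ ℝ fun σ => σ * Equiv.swap i j)
  let χ : TableauPair n → Fin n ⊕ Fin n → ℝ := fun x =>
    Sum.elim (x.2.1.weight n) (x.2.2.weight n)
  have hdet : ∀ (μ μ' : YoungDiagramOfSize n) (T : StandardYoungTableau μ.1)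
      (T' : StandardYoungTableau μ'.1), T.weight n = T'.weight n →
      (⟨μ, T⟩ : Σ μ : YoungDiagramOfSize n, StandardYoungTableau μ.1) = ⟨μ', T'⟩ := by
    intro μ μ' T T' h
    refine StandardYoungTableau.eq_of_diagonal_eq n _ _ fun m hm hm' => ?_
    have h1 := congrFun h ⟨m - 1, by omega⟩
    simpa [StandardYoungTableau.weight, Nat.sub_add_cancel hm] using h1
  have hχ : Function.Injective χ := by
    rintro ⟨μ, S, T⟩ ⟨μ', S', T'⟩ h
    have h1 := hdet μ μ' S S' (funext fun j => congrFun h (Sum.inl j))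
    have h2 := hdet μ μ' T T' (funext fun j => congrFun h (Sum.inr j))
    obtain rfl : μ = μ' := congrArg Sigma.fst h1
    simp only [Sigma.mk.injEq, heq_eq_eq, true_and] at h1 h2
    rw [h1, h2]
  have hli : LinearIndependent ℝ v := by
    refine linearIndependent_of_joint_eigenvectors A χ hχ v hv fun x k => ?_
    rcases k with j | j
    · ext σ
      simpa [A, χ, LinearMap.funLeft_apply] using hl x j σ
    · ext σ
      simpa [A, χ, LinearMap.funLeft_apply] using hr x j σ
  have hcard : Fintype.card (TableauPair n) = Module.finrank ℝ (Equiv.Perm (Fin n) → ℝ) := by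
    rw [card_tableauPair, Module.finrank_fintype_fun_eq_card, Fintype.card_perm, Fintype.card_fin]
  have : Nonempty (TableauPair n) := Fintype.card_pos_iff.1 (by
    rw [card_tableauPair]; exact n.factorial_pos)
  refine ⟨basisOfLinearIndependentOfCardEqFinrank hli hcard, fun x j σ => ?_⟩
  rw [coe_basisOfLinearIndependentOfCardEqFinrank]
  exact hl x j σ

/-- In the basis of pairs the shuffle is diagonal with an eigenvalue depending on the first tableau
only; the free second tableau accounts for the exponent. -/
theorem charpoly_biasedShuffle (w : ℕ → ℝ) (n : ℕ) :
    (biasedShuffle w n).charpoly =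
      ∏ μ : YoungDiagramOfSize n, ∏ T : StandardYoungTableau μ.1,
        (X - C (T.eig w)) ^ μ.1.dimension := by
  classical
  obtain ⟨b, hb⟩ := exists_basis_jucysMurphy n
  have heig : ∀ x, Matrix.toLin' (biasedShuffle w n) (b x) = x.2.1.eig w • b x := by
    intro x
    ext σ
    rw [Matrix.toLin'_apply, biasedShuffle_mulVec, Pi.smul_apply, smul_eq_mul,
      x.2.1.eig_eq_sum w n x.1.2, Finset.mul_sum, Finset.sum_mul, ← Finset.Ico_add_one_right_eq_Icc,
      Finset.sum_Ico_eq_sum_range, Nat.add_sub_cancel, Finset.sum_range]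
    refine Finset.sum_congr rfl fun j _ => ?_
    -- The identity term adds one to the content `j - i`, giving `T(m) = j - i + 1`.
    rw [hb, StandardYoungTableau.weight]
    rw [add_comm 1 (j : ℕ)]
    push_cast
    ring
  have hdiag : LinearMap.toMatrix b b (Matrix.toLin' (biasedShuffle w n)) =
      Matrix.diagonal fun x => x.2.1.eig w := by
    ext x y
    rw [LinearMap.toMatrix_apply, heig, map_smul, Module.Basis.repr_self, Finsupp.smul_apply,
      Matrix.diagonal_apply, Finsupp.single_apply]
    by_cases h : x = y
    · subst h; simp
    · simp [h, Ne.symm h]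
  rw [← Matrix.charpoly_toLin', ← LinearMap.charpoly_toMatrix _ b, hdiag, Matrix.charpoly_diagonal,
    Fintype.prod_sigma]
  refine Finset.prod_congr rfl fun μ _ => ?_
  rw [Fintype.prod_prod_type]
  refine Finset.prod_congr rfl fun T _ => ?_
  rw [YoungDiagram.dimension, ← Finset.card_univ]
  exact Finset.prod_const (X - C (T.eig w))

end

theorem lemma4p1 (n : ℕ) (hn : 1 ≤ n) (w : ℕ → ℝ) (hw : ∀ j, 1 ≤ j → 0 < w j) :
    -- the eigenvalues are exactly the numbers `eig(T)`, over the standard Young tableaux of size `n`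
    (∀ x : ℝ, Module.End.HasEigenvalue (Matrix.toLin' (biasedShuffle w n)) x ↔
      ∃ (μ : YoungDiagramOfSize n) (T : StandardYoungTableau μ.1), T.eig w = x) ∧
    -- with multiplicity: each tableau of shape `μ` accounts for `d_μ` eigenvalues
    (biasedShuffle w n).charpoly =
      ∏ μ : YoungDiagramOfSize n, ∏ T : StandardYoungTableau μ.1,
        (X - C (T.eig w)) ^ μ.1.dimension ∧
    -- the second formula for `eig(T)`
    (∀ (μ : YoungDiagramOfSize n) (T : StandardYoungTableau μ.1),
      T.eig w = 1 / cumulativeWeight w n *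
        ∑ m ∈ Finset.Icc 1 n, (T.diagonal m : ℝ) * (w m / (m : ℝ))) := by
  refine ⟨fun x => ?_, charpoly_biasedShuffle w n, fun μ T => T.eig_eq_sum w n μ.2⟩
  rw [Module.End.hasEigenvalue_iff_isRoot_charpoly, Matrix.charpoly_toLin',
    charpoly_biasedShuffle, IsRoot.def, eval_prod, Finset.prod_eq_zero_iff]
  constructor
  · rintro ⟨μ, -, h⟩
    rw [eval_prod, Finset.prod_eq_zero_iff] at h
    obtain ⟨T, -, h⟩ := h
    rw [eval_pow, eval_sub, eval_X, eval_C] at h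
    -- The exponent `d_μ` is positive because `T` itself is a tableau of shape `μ`.
    exact ⟨μ, T, (sub_eq_zero.1 (pow_eq_zero_iff (Fintype.card_pos_iff.2 ⟨T⟩).ne' |>.1 h)).symm⟩
  · rintro ⟨μ, T, rfl⟩
    refine ⟨μ, Finset.mem_univ _, ?_⟩
    rw [eval_prod, Finset.prod_eq_zero_iff]
    refine ⟨T, Finset.mem_univ _, ?_⟩
    rw [eval_pow, eval_sub, eval_X, eval_C, sub_self]
    exact zero_pow (Fintype.card_pos_iff.2 ⟨T⟩).ne'
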